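/- Fix $b,\Delta\in(0,1)$. Let $\mathcal V_{b,\Delta}$ be the space of sequences $\alpha=(\alpha_j)_{j\ge 0}$ of complex numbers with $|\alpha_j|<1$ for all $j$ such that, for some (necessarily unique) $C=C(\alpha)\neq 0$, \[ \|\alpha\| := |C|+\sum_{j=0}^\infty \bigl|(\alpha_j-Cb^j)\,\Delta^{-j}b^{-j}\bigr|<\infty , \] with the topology of the distance \[ d(\alpha,\beta)=|C(\alpha)-C(\beta)|+\sum_{j=0}^\infty\bigl|\bigl(\alpha_j-\beta_j-(C(\alpha)-C(\beta))b^j\bigr)\Delta^{-j}b^{-j}\bigr| . \] Let $d\mu=w\,\frac{d\theta}{2\pi}+d\mu_{\mathrm s}$ be the nontrivial (not finitely supported) probability measure on the unit circle whose Verblunsky coefficients are $\alpha$, that is, $\alpha_n=-\overline{\Phi_{n+1}(0)}$, where $\Phi_n$ is the monic orthogonal polynomial of degree $n$ in $L^2(d\mu)$. Let \[ D(z)=\exp\Bigl(\frac1{4\pi}\int_0^{2\pi}\frac{e^{i\theta}+z}{e^{i\theta}-z}\,\log w(\theta)\,d\theta\Bigr),\qquad |z|<1, \] be its Szeg\H{o}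 function. For $\alpha\in\mathcal V_{b,\Delta}$, $\mu$ satisfies the Szeg\H{o} condition ($w>0$ a.e. and $\log w\in L^1$), and $D(z)^{-1}$ has a meromorphic continuation, again written $D(z)^{-1}$, to a disk $\{|z|<R\}$ with $R>b^{-1}$, analytic except at $z=b^{-1}$. A point $z$ with $|z|=b$ is called singular if $z=b$ or $D(1/\bar z)^{-1}=0$. Then \[ \{\alpha\in\mathcal V_{b,\Delta} \mid \text{the only singular point on } |z|=b \text{ is } z=b\} \] is a dense open subset of $\mathcal V_{b,\Delta}$. -/

import Mathlib

open MeasureTheory Set Filter Topology Polynomial ComplexConjugate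

namespace OPUC

noncomputable section

/-! ### Measures on the unit circle and their Verblunsky coefficients -/

/-- Normalized arc length `dθ / 2π` on the unit circle, as a measure on `ℂ`. -/
def arcMeasure : Measure ℂ :=
  ENNReal.ofReal (1 / (2 * Real.pi)) •
    (volume.restrict (Ioc (0 : ℝ) (2 * Real.pi))).map (circleMap 0 1)

/-- A nontrivial probability measure on the unit circle: it lives on `{|z| = 1}` and it is not
supported on a finite set. -/
structure IsNontrivialCircleMeasure (μ : Measure ℂ) : Prop where
  isProbabilityMeasure : IsProbabilityMeasure μ
  compl_circle : μ (Metric.sphere (0 : ℂ) 1)ᶜ = 0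
  not_finite : ∀ s : Set ℂ, s.Finite → μ sᶜ ≠ 0

/-- `P` is the monic orthogonal polynomial of degree `n` for `μ`, that is, it is monic of degree
`n` and orthogonal in `L²(μ)` to `1, z, …, z ^ (n - 1)`. For a nontrivial measure there is exactly
one such polynomial for each `n`. -/
def IsMonicOP (μ : Measure ℂ) (n : ℕ) (P : ℂ[X]) : Prop :=
  P.Monic ∧ P.natDegree = n ∧ ∀ k < n, ∫ z, conj (z ^ k) * P.eval z ∂μ = 0

/-- `α` is the sequence of Verblunsky coefficients of `μ`: `α n = -conj (Φ_{n+1}(0))`. -/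
def HasVerblunskyCoeffs (μ : Measure ℂ) (α : ℕ → ℂ) : Prop :=
  ∃ Φ : ℕ → ℂ[X], (∀ n, IsMonicOP μ n (Φ n)) ∧ ∀ n, α n = -conj ((Φ (n + 1)).eval 0)

/-! ### The Szegő function -/

/-- The weight `w` in the decomposition `dμ = w dθ/2π + dμ_s`. -/
def weight (μ : Measure ℂ) (ζ : ℂ) : ℝ := (μ.rnDeriv arcMeasure ζ).toReal

/-- The Szegő condition `∫ log w dθ/2π > -∞`. Since `Real.log 0 = 0`, positivity of `w` almost
everywhere is demanded separately. -/
def SzegoCondition (μ : Measure ℂ) : Prop :=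
  (∀ᵐ ζ ∂arcMeasure, 0 < weight μ ζ) ∧
    Integrable (fun ζ => Real.log (weight μ ζ)) arcMeasure

/-- The Szegő function
`D(z) = exp ((1 / 4π) ∫ (e^{iθ} + z) / (e^{iθ} - z) log w(θ) dθ)`, for `|z| < 1`. -/
def szegoFunction (μ : Measure ℂ) (z : ℂ) : ℂ :=
  Complex.exp (1 / 2 * ∫ ζ, (ζ + z) / (ζ - z) * (Real.log (weight μ ζ) : ℂ) ∂arcMeasure)

/-- `G` is the continuation of `D(z)⁻¹` (a priori defined for `|z| < 1` only) to a disk of radius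
larger than `b⁻¹`, meromorphic there and analytic except at `z = b⁻¹`. Two such continuations
agree on the intersection of their disks, outside `b⁻¹`. -/
def IsSzegoInverseContinuation (b : ℝ) (μ : Measure ℂ) (G : ℂ → ℂ) : Prop :=
  ∃ R : ℝ, b⁻¹ < R ∧
    MeromorphicOn G (Metric.ball 0 R) ∧
    AnalyticOnNhd ℂ G (Metric.ball 0 R \ {(b : ℂ)⁻¹}) ∧
    ∀ z ∈ Metric.ball (0 : ℂ) 1, G z = (szegoFunction μ z)⁻¹

/-- The singular points on `|z| = b`: the point `z = b` and the points where the continuation `G`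
of `D⁻¹` satisfies `G (1 / conj z) = 0`. -/
def singularPoints (b : ℝ) (G : ℂ → ℂ) : Set ℂ :=
  {z | ‖z‖ = b ∧ (z = b ∨ G (1 / conj z) = 0)}

/-- The only singular point on `|z| = b` of the measure with Verblunsky coefficients `α`
is `z = b`. -/
def OnlySingularPoint (b : ℝ) (α : ℕ → ℂ) : Prop :=
  ∃ (μ : Measure ℂ) (G : ℂ → ℂ), IsNontrivialCircleMeasure μ ∧ HasVerblunskyCoeffs μ α ∧
    SzegoCondition μ ∧ IsSzegoInverseContinuation b μ G ∧ singularPoints b G = {(b : ℂ)}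

/-! ### The space `V_{b,Δ}` -/

/-- The weighted remainder `(γ_j - C b^j) Δ^{-j} b^{-j}`. -/
def remainder (b Δ : ℝ) (C : ℂ) (γ : ℕ → ℂ) (j : ℕ) : ℂ :=
  (γ j - C * (b : ℂ) ^ j) * ((Δ : ℂ) ^ j)⁻¹ * ((b : ℂ) ^ j)⁻¹

/-- `∑_j |(γ_j - C b^j) Δ^{-j} b^{-j}| < ∞`. -/
def IsLeading (b Δ : ℝ) (γ : ℕ → ℂ) (C : ℂ) : Prop :=
  Summable fun j => ‖remainder b Δ C γ j‖

/-- The space of sequences `α` in `×_j 𝔻` such that, for some `C ≠ 0`,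
`∑_j |(α_j - C b^j) Δ^{-j} b^{-j}| < ∞`. -/
def V (b Δ : ℝ) : Type :=
  {α : ℕ → ℂ // (∀ j, ‖α j‖ < 1) ∧ ∃ C : ℂ, C ≠ 0 ∧ IsLeading b Δ α C}

variable {b Δ : ℝ}

/-- The constant `C` of a sequence in `V b Δ` (unique by `IsLeading.unique`). -/
def V.C (α : V b Δ) : ℂ := α.2.2.choose

theorem V.C_ne_zero (α : V b Δ) : α.C ≠ 0 := α.2.2.choose_spec.1

theorem V.isLeading (α : V b Δ) : IsLeading b Δ α.1 α.C := α.2.2.choose_spec.2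

theorem remainder_sub (C C' : ℂ) (γ γ' : ℕ → ℂ) (j : ℕ) :
    remainder b Δ (C - C') (γ - γ') j = remainder b Δ C γ j - remainder b Δ C' γ' j := by
  simp only [remainder, Pi.sub_apply]; ring

theorem IsLeading.sub {C C' : ℂ} {γ γ' : ℕ → ℂ} (h : IsLeading b Δ γ C)
    (h' : IsLeading b Δ γ' C') : IsLeading b Δ (γ - γ') (C - C') := by
  refine Summable.of_nonneg_of_le (fun _ => norm_nonneg _) (fun j => ?_) (Summable.add h h')
  rw [remainder_sub]
  exact norm_sub_le _ _

/-- The constant `C` is determined by the sequence. -/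
theorem IsLeading.unique (hb : 0 < b) (hΔ : Δ ∈ Ioo (0 : ℝ) 1) {γ : ℕ → ℂ} {C C' : ℂ}
    (h : IsLeading b Δ γ C) (h' : IsLeading b Δ γ C') : C = C' := by
  have h0 : Tendsto (fun j => ‖remainder b Δ (C - C') (γ - γ) j‖) atTop (𝓝 0) :=
    (h.sub h').tendsto_atTop_zero
  have hle : ∀ j, ‖C - C'‖ ≤ ‖remainder b Δ (C - C') (γ - γ) j‖ := by
    intro j
    have hb' : (b : ℂ) ^ j ≠ 0 := pow_ne_zero _ (by exact_mod_cast hb.ne')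
    have e : remainder b Δ (C - C') (γ - γ) j = -((C - C') * ((Δ : ℂ) ^ j)⁻¹) := by
      simp only [remainder, sub_self, Pi.zero_apply]
      field_simp
      ring
    rw [e, norm_neg, norm_mul, norm_inv, norm_pow, Complex.norm_real, Real.norm_eq_abs,
      abs_of_pos hΔ.1]
    exact le_mul_of_one_le_right (norm_nonneg _)
      (one_le_inv_iff₀.2 ⟨pow_pos hΔ.1 _, pow_le_one₀ hΔ.1.le hΔ.2.le⟩)
  have := le_of_tendsto' (tendsto_const_nhds.sub h0) (fun j => sub_nonpos.2 (hle j))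
  rw [sub_zero] at this
  exact sub_eq_zero.1 (norm_le_zero_iff.1 this)

/-- `|C| + ∑_j |(γ_j - C b^j) Δ^{-j} b^{-j}|`. -/
def vNorm (b Δ : ℝ) (C : ℂ) (γ : ℕ → ℂ) : ℝ := ‖C‖ + ∑' j, ‖remainder b Δ C γ j‖

/-- The topology of `V b Δ` is that of the distance `‖α - β‖`, where `‖·‖` is the norm
`|C| + ∑_j |(γ_j - C b^j) Δ^{-j} b^{-j}|`; the constant that belongs to `α - β` is the difference
of those of `α` and `β`. -/
instance : PseudoMetricSpace (V b Δ) where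
  dist α β := vNorm b Δ (α.C - β.C) (α.1 - β.1)
  dist_self α := by simp [vNorm, remainder]
  dist_comm α β := by
    have e : ∀ j, ‖remainder b Δ (α.C - β.C) (α.1 - β.1) j‖
        = ‖remainder b Δ (β.C - α.C) (β.1 - α.1) j‖ := by
      intro j; rw [remainder_sub, remainder_sub, norm_sub_rev]
    simp only [vNorm, e, norm_sub_rev α.C β.C]
  dist_triangle α β γ := by
    have h1 := α.isLeading.sub β.isLeading
    have h2 := β.isLeading.sub γ.isLeading
    have h3 := α.isLeading.sub γ.isLeading
    have hs : ∑' j, ‖remainder b Δ (α.C - γ.C) (α.1 - γ.1) j‖ ≤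
        ∑' j, ‖remainder b Δ (α.C - β.C) (α.1 - β.1) j‖ +
          ∑' j, ‖remainder b Δ (β.C - γ.C) (β.1 - γ.1) j‖ := by
      rw [← Summable.tsum_add h1 h2]
      refine Summable.tsum_le_tsum (fun j => ?_) h3 (Summable.add h1 h2)
      rw [remainder_sub, remainder_sub, remainder_sub]
      exact norm_sub_le_norm_sub_add_norm_sub _ _ _
    have hc := norm_sub_le_norm_sub_add_norm_sub α.C β.C γ.C
    simp only [vNorm]
    linarith

end

end OPUC

/-! Write `u_n = Φ_n(z)` and `v_n = Φ_n^*(z)`. Since `α_n` behaves like `C b ^ n`, the sequence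
`v_n` converges only for `|z| < b⁻¹`. The corrected sequence `(1 - b z) v_n - z α_n u_n` has
increments involving only `α_{n+1} - b α_n` and `|α_n|²`. It therefore converges to a function
`K(z)` analytic past the circle `|z| = b⁻¹`, jointly continuous in `(α, z)` (`szegoCont`,
`Rates.continuousOn_szegoCont`). Inside that circle `lim v_n = K / (1 - b z)`, and `D⁻¹` is a
nonzero constant times this limit. Moreover `K(b⁻¹) ≠ 0` because `C ≠ 0`. So the condition on
singular points says that `K` has no zero on the circle `|z| = b⁻¹` (`Rates.onlySingularPoint_iff`);
turning it into this form requires constructing the measure and proving that both it and the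
continuation are unique.

Openness follows from joint continuity of `K` and compactness of the circle.

For density only one coefficient `α_N` is changed, to `a`. Then `K(z) = 0` is a real-affine equation
in `a`, namely `p = conj a * q + a * s`. For `N` large the tail is close to the zero sequence, for
which `q = 0` and `s ≠ 0` away from `b⁻¹`. Hence `|q| < |s|`, and the equation has one solution `a`
for each `z` of the circle outside a neighbourhood of `b⁻¹`. These solutions lie on a `C¹` curve in
the plane, whose complement is dense, so `a` can be taken off it and arbitrarily close to `α_N`.
Near `b⁻¹`, small perturbations keep `K ≠ 0` by continuity (`Rates.eventually_tail_lt`,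
`dense_compl_solutions`, `Rates.dense_compl_update`). -/

namespace OPUC

noncomputable section

/-! ### The Szegő recursion as a transfer matrix -/

/-- One step of the Szegő recursion, applied to the pair `(Φ_n(z), Φ_n^*(z))`. -/
def szegoStep (a z : ℂ) (w : ℂ × ℂ) : ℂ × ℂ :=
  (z * w.1 - conj a * w.2, w.2 - a * z * w.1)

/-- The solution of the Szegő recursion with initial value `w`. -/
def szegoSol (α : ℕ → ℂ) (z : ℂ) (w : ℂ × ℂ) : ℕ → ℂ × ℂ
  | 0 => w
  | n + 1 => szegoStep (α n) z (szegoSol α z w n)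

@[simp] theorem szegoSol_zero (α : ℕ → ℂ) (z : ℂ) (w : ℂ × ℂ) : szegoSol α z w 0 = w := rfl

theorem szegoSol_succ_fst (α : ℕ → ℂ) (z : ℂ) (w : ℂ × ℂ) (n : ℕ) :
    (szegoSol α z w (n + 1)).1
      = z * (szegoSol α z w n).1 - conj (α n) * (szegoSol α z w n).2 := rfl

theorem szegoSol_succ_snd (α : ℕ → ℂ) (z : ℂ) (w : ℂ × ℂ) (n : ℕ) :
    (szegoSol α z w (n + 1)).2
      = (szegoSol α z w n).2 - α n * z * (szegoSol α z w n).1 := rfl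

theorem szegoSol_add (α : ℕ → ℂ) (z : ℂ) (w : ℂ × ℂ) (N n : ℕ) :
    szegoSol α z w (N + n) = szegoSol (fun k => α (N + k)) z (szegoSol α z w N) n := by
  induction n with
  | zero => rfl
  | succ n ih => rw [← add_assoc, szegoSol, szegoSol, ih]

theorem szegoSol_congr {α β : ℕ → ℂ} (z : ℂ) (w : ℂ × ℂ) (n : ℕ) (h : ∀ k < n, α k = β k) :
    szegoSol α z w n = szegoSol β z w n := by
  induction n with
  | zero => rfl
  | succ n ih =>
    rw [szegoSol, szegoSol, ih fun k hk => h k (by omega), h n (by omega)]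

theorem szegoSol_linear (α : ℕ → ℂ) (z : ℂ) (w : ℂ × ℂ) (n : ℕ) :
    szegoSol α z w n = w.1 • szegoSol α z (1, 0) n + w.2 • szegoSol α z (0, 1) n := by
  induction n with
  | zero => ext <;> simp
  | succ n ih =>
    rw [szegoSol, szegoSol, szegoSol, ih]
    ext <;> simp [szegoStep] <;> ring

theorem norm_szegoStep_le {a z : ℂ} {r : ℝ} (hr : 1 ≤ r) (hz : ‖z‖ ≤ r) (w : ℂ × ℂ) :
    ‖szegoStep a z w‖ ≤ r * (1 + ‖a‖) * ‖w‖ := by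
  have h1 := norm_fst_le w
  have h2 := norm_snd_le w
  have ha := norm_nonneg a
  have hw := norm_nonneg w
  refine norm_prod_le_iff.2 ⟨?_, ?_⟩
  · calc ‖z * w.1 - conj a * w.2‖ ≤ ‖z‖ * ‖w.1‖ + ‖a‖ * ‖w.2‖ := by
          refine (norm_sub_le _ _).trans_eq ?_
          simp
      _ ≤ r * ‖w‖ + (r * ‖a‖) * ‖w‖ := by
          gcongr
          exact le_mul_of_one_le_left ha hr
      _ = _ := by ring
  · calc ‖w.2 - a * z * w.1‖ ≤ ‖w.2‖ + ‖a‖ * ‖z‖ * ‖w.1‖ := by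
          refine (norm_sub_le _ _).trans_eq ?_
          simp
      _ ≤ r * ‖w‖ + ‖a‖ * r * ‖w‖ := by
          gcongr
          exact h2.trans (le_mul_of_one_le_left hw hr)
      _ = _ := by ring

theorem norm_szegoSol_le (α : ℕ → ℂ) {z : ℂ} {r : ℝ} (hr : 1 ≤ r) (hz : ‖z‖ ≤ r) (w : ℂ × ℂ)
    (n : ℕ) :
    ‖szegoSol α z w n‖ ≤ r ^ n * Real.exp (∑ k ∈ Finset.range n, ‖α k‖) * ‖w‖ := by
  induction n with
  | zero => simp
  | succ n ih =>
    rw [szegoSol]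
    refine (norm_szegoStep_le hr hz _).trans ?_
    have h1 : 1 + ‖α n‖ ≤ Real.exp ‖α n‖ := by
      rw [add_comm]; exact Real.add_one_le_exp _
    calc r * (1 + ‖α n‖) * ‖szegoSol α z w n‖
        ≤ r * Real.exp ‖α n‖ * (r ^ n * Real.exp (∑ k ∈ Finset.range n, ‖α k‖) * ‖w‖) := by
          gcongr
      _ = _ := by rw [Finset.sum_range_succ, Real.exp_add]; ring

theorem continuous_szegoSol (w : ℂ × ℂ) (n : ℕ) :
    Continuous fun p : (ℕ → ℂ) × ℂ => szegoSol p.1 p.2 w n := by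
  induction n with
  | zero => exact continuous_const
  | succ n ih =>
    simp only [szegoSol, szegoStep]
    fun_prop

theorem differentiable_szegoSol (α : ℕ → ℂ) (w : ℂ × ℂ) (n : ℕ) :
    Differentiable ℂ (fun z => (szegoSol α z w n).1) ∧
      Differentiable ℂ (fun z => (szegoSol α z w n).2) := by
  induction n with
  | zero => exact ⟨differentiable_const (c := w.1), differentiable_const (c := w.2)⟩
  | succ n ih =>
    obtain ⟨h1, h2⟩ := ih
    simp only [szegoSol_succ_fst, szegoSol_succ_snd]
    exact ⟨by fun_prop, by fun_prop⟩

/-! ### Inside and outside the unit disk -/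

/-- Up to the factor `1 - |a|²`, a step preserves the indefinite form `|v|² - |u|²` once `u` is
multiplied by `z`. This decides which component dominates inside and outside the unit circle. -/
theorem normSq_szegoStep (a z : ℂ) (w : ℂ × ℂ) :
    Complex.normSq (szegoStep a z w).2 - Complex.normSq (szegoStep a z w).1
      = (1 - Complex.normSq a) * (Complex.normSq w.2 - Complex.normSq (z * w.1)) := by
  simp only [szegoStep, Complex.normSq_apply, Complex.sub_re, Complex.sub_im, Complex.mul_re,
    Complex.mul_im, Complex.conj_re, Complex.conj_im]
  ring

theorem norm_fst_le_norm_snd_szegoSol {α : ℕ → ℂ} (hα : ∀ j, ‖α j‖ < 1) {z : ℂ} (hz : ‖z‖ ≤ 1)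
    (n : ℕ) : ‖(szegoSol α z (1, 1) n).1‖ ≤ ‖(szegoSol α z (1, 1) n).2‖ := by
  induction n with
  | zero => simp
  | succ n ih =>
    have h := normSq_szegoStep (α n) z (szegoSol α z (1, 1) n)
    simp only [Complex.normSq_eq_norm_sq, norm_mul] at h
    have h1 : ‖z‖ * ‖(szegoSol α z (1, 1) n).1‖ ≤ ‖(szegoSol α z (1, 1) n).2‖ :=
      (mul_le_of_le_one_left (norm_nonneg _) hz).trans ih
    have h2 : (‖z‖ * ‖(szegoSol α z (1, 1) n).1‖) ^ 2 ≤ ‖(szegoSol α z (1, 1) n).2‖ ^ 2 := by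
      gcongr
    have h3 : ‖α n‖ ^ 2 ≤ 1 := pow_le_one₀ (norm_nonneg _) (hα n).le
    have h4 := mul_nonneg (sub_nonneg.2 h3) (sub_nonneg.2 h2)
    rw [← h] at h4
    exact (pow_le_pow_iff_left₀ (norm_nonneg _) (norm_nonneg _) two_ne_zero).1 (sub_nonneg.1 h4)

/-- On `|z| = b⁻¹` this is what makes the equation for a single coefficient invertible. -/
theorem norm_snd_le_norm_fst_szegoSol {α : ℕ → ℂ} (hα : ∀ j, ‖α j‖ < 1) {z : ℂ} (hz : 1 ≤ ‖z‖)
    (n : ℕ) : ‖(szegoSol α z (1, 1) n).2‖ ≤ ‖(szegoSol α z (1, 1) n).1‖ ∧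
      (szegoSol α z (1, 1) n).1 ≠ 0 := by
  induction n with
  | zero => simp
  | succ n ih =>
    obtain ⟨ih, ih0⟩ := ih
    have h := normSq_szegoStep (α n) z (szegoSol α z (1, 1) n)
    simp only [Complex.normSq_eq_norm_sq, norm_mul] at h
    have h1 : ‖(szegoSol α z (1, 1) n).2‖ ≤ ‖z‖ * ‖(szegoSol α z (1, 1) n).1‖ :=
      ih.trans (le_mul_of_one_le_left (norm_nonneg _) hz)
    constructor
    · have h2 : ‖(szegoSol α z (1, 1) n).2‖ ^ 2 ≤ (‖z‖ * ‖(szegoSol α z (1, 1) n).1‖) ^ 2 := by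
        gcongr
      have h3 : ‖α n‖ ^ 2 ≤ 1 := pow_le_one₀ (norm_nonneg _) (hα n).le
      have h4 := mul_nonneg (sub_nonneg.2 h3) (sub_nonneg.2 h2)
      refine (pow_le_pow_iff_left₀ (norm_nonneg _) (norm_nonneg _) two_ne_zero).1 ?_
      have : (1 - ‖α n‖ ^ 2) * ((‖z‖ * ‖(szegoSol α z (1, 1) n).1‖) ^ 2
        - ‖(szegoSol α z (1, 1) n).2‖ ^ 2) = -((1 - ‖α n‖ ^ 2) *
        (‖(szegoSol α z (1, 1) n).2‖ ^ 2 - (‖z‖ * ‖(szegoSol α z (1, 1) n).1‖) ^ 2)) := by ring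
      rw [this, ← h] at h4
      simp only [szegoSol] at *
      linarith
    · intro h0
      rw [szegoSol_succ_fst, sub_eq_zero] at h0
      have h5 := congrArg norm h0
      rw [norm_mul, norm_mul, RCLike.norm_conj] at h5
      have h6 : 0 < ‖z‖ * ‖(szegoSol α z (1, 1) n).1‖ :=
        mul_pos (by linarith) (norm_pos_iff.2 ih0)
      have h7 := mul_le_mul_of_nonneg_left h1 (norm_nonneg (α n))
      nlinarith [hα n]

/-- The reversal symmetry `Φ_n^*(z) = z ^ n conj (Φ_n (1 / conj z))`, which exchanges the inside and
the outside of the unit circle. -/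
theorem szegoSol_reflect (α : ℕ → ℂ) {z : ℂ} (hz : z ≠ 0) (n : ℕ) :
    (szegoSol α z (1, 1) n).1 = z ^ n * conj (szegoSol α (conj z)⁻¹ (1, 1) n).2 ∧
      (szegoSol α z (1, 1) n).2 = z ^ n * conj (szegoSol α (conj z)⁻¹ (1, 1) n).1 := by
  induction n with
  | zero => simp
  | succ n ih =>
    obtain ⟨h1, h2⟩ := ih
    rw [szegoSol_succ_fst, szegoSol_succ_snd, szegoSol_succ_fst, szegoSol_succ_snd, h1, h2]
    simp only [map_sub, map_mul, map_inv₀, Complex.conj_conj]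
    constructor <;> field_simp <;> ring

theorem exists_pos_tendsto_prod_one_sub {a : ℕ → ℝ} (h0 : ∀ j, 0 ≤ a j) (h1 : ∀ j, a j < 1)
    (hs : Summable a) :
    ∃ p > 0, Tendsto (fun n => ∏ k ∈ Finset.range n, (1 - a k)) atTop (𝓝 p) ∧
      ∀ n, p ≤ ∏ k ∈ Finset.range n, (1 - a k) := by
  have hpos : ∀ n, 0 < ∏ k ∈ Finset.range n, (1 - a k) :=
    fun n => Finset.prod_pos fun k _ => sub_pos.2 (h1 k)
  have hs' : Summable fun k => ‖-a k‖ := by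
    simpa only [norm_neg, Real.norm_eq_abs, abs_of_nonneg (h0 _)] using hs
  have hm : Multipliable fun k => 1 + -a k := multipliable_one_add_of_summable hs'
  have hne : ∏' k, (1 + -a k) ≠ 0 :=
    tprod_one_add_ne_zero_of_summable (fun k => by have := h1 k; linarith) hs'
  have hlim : Tendsto (fun n => ∏ k ∈ Finset.range n, (1 - a k)) atTop
      (𝓝 (∏' k, (1 + -a k))) := by
    simpa only [← sub_eq_add_neg] using hm.hasProd.tendsto_prod_nat
  have hanti : Antitone fun n => ∏ k ∈ Finset.range n, (1 - a k) := by
    refine antitone_nat_of_succ_le fun n => ?_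
    rw [Finset.prod_range_succ]
    exact mul_le_of_le_one_right (hpos n).le (by linarith [h0 n])
  exact ⟨_, lt_of_le_of_ne (ge_of_tendsto' hlim fun n => (hpos n).le) hne.symm, hlim,
    fun n => hanti.le_of_tendsto hlim n⟩

/-- `Φ_n^*` is bounded away from zero on the closed disk, uniformly in `n`. -/
theorem exists_le_norm_snd_szegoSol {α : ℕ → ℂ} (hα : ∀ j, ‖α j‖ < 1)
    (hs : Summable fun j => ‖α j‖) :
    ∃ δ > 0, ∀ z : ℂ, ‖z‖ ≤ 1 → ∀ n, δ ≤ ‖(szegoSol α z (1, 1) n).2‖ := by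
  -- In the closed disk `Φ_n` is dominated by `Φ_n^*`, so one step costs at most the factor `1 -
  -- |α_n|`; the product of these factors stays positive by summability.
  have hstep : ∀ z : ℂ, ‖z‖ ≤ 1 → ∀ n, (1 - ‖α n‖) * ‖(szegoSol α z (1, 1) n).2‖
      ≤ ‖(szegoSol α z (1, 1) (n + 1)).2‖ := by
    intro z hz n
    have h1 := norm_fst_le_norm_snd_szegoSol hα hz n
    have h2 := norm_sub_norm_le (szegoSol α z (1, 1) n).2 (α n * z * (szegoSol α z (1, 1) n).1)
    rw [← szegoSol_succ_snd, norm_mul, norm_mul] at h2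
    have h3 : ‖α n‖ * ‖z‖ * ‖(szegoSol α z (1, 1) n).1‖
        ≤ ‖α n‖ * 1 * ‖(szegoSol α z (1, 1) n).2‖ := by gcongr
    linarith
  have hprod : ∀ z : ℂ, ‖z‖ ≤ 1 → ∀ n, ∏ k ∈ Finset.range n, (1 - ‖α k‖)
      ≤ ‖(szegoSol α z (1, 1) n).2‖ := by
    intro z hz n
    induction n with
    | zero => simp
    | succ n ih =>
      rw [Finset.prod_range_succ, mul_comm]
      exact (mul_le_mul_of_nonneg_left ih (sub_nonneg.2 (hα n).le)).trans (hstep z hz n)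
  obtain ⟨p, hp, -, hle⟩ := exists_pos_tendsto_prod_one_sub (fun j => norm_nonneg (α j)) hα hs
  exact ⟨p, hp, fun z hz n => (hle n).trans (hprod z hz n)⟩

/-! ### The continuation of `(1 - b z) Φ_∞^*(z)` beyond the unit disk -/

/-- The sequences with `|α n| ≤ M b ^ n` and `|α (n + 1) - b α n| ≤ M t ^ n`. -/
def decaySet (b t M : ℝ) : Set (ℕ → ℂ) :=
  {α | ∀ n, ‖α n‖ ≤ M * b ^ n ∧ ‖α (n + 1) - b * α n‖ ≤ M * t ^ n}

/-- The general term of the series in `szegoCont`. -/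
def szegoTerm (b : ℝ) (α : ℕ → ℂ) (z : ℂ) (w : ℂ × ℂ) (n : ℕ) : ℂ :=
  (α (n + 1) - b * α n) * (szegoSol α z w (n + 1)).1
    - b * (α n * conj (α n)) * (szegoSol α z w n).2

/-- The limit of `(1 - b z) v_n - z α_n u_n` along the solution `(u_n, v_n)` of the Szegő recursion
with initial value `w`; for `|z| < b⁻¹` it is the limit of `(1 - b z) v_n`. -/
def szegoCont (b : ℝ) (α : ℕ → ℂ) (z : ℂ) (w : ℂ × ℂ) : ℂ :=
  (1 - b * z) * w.2 - z * (α 0 * w.1 + ∑' n, szegoTerm b α z w n)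

/-- Constraints on the rates of decay `b`, `t` and the radius `r` under which the series defining
`szegoCont` converges for `|z| ≤ r`. -/
structure Rates (b t r : ℝ) : Prop where
  b_pos : 0 < b
  b_lt_one : b < 1
  t_nonneg : 0 ≤ t
  one_le : 1 ≤ r
  mul_t_lt_one : r * t < 1
  mul_sq_lt_one : r * b ^ 2 < 1

variable {b t r M : ℝ}

theorem nonneg_of_mem_decaySet {α : ℕ → ℂ} (hα : α ∈ decaySet b t M) : 0 ≤ M := by
  have := (norm_nonneg _).trans (hα 0).1
  simpa using this

theorem summable_norm_of_mem_decaySet (hb : 0 < b) (hb1 : b < 1) {α : ℕ → ℂ}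
    (hα : α ∈ decaySet b t M) : Summable fun n => ‖α n‖ :=
  Summable.of_nonneg_of_le (fun _ => norm_nonneg _) (fun n => (hα n).1)
    ((summable_geometric_of_lt_one hb.le hb1).mul_left M)

theorem sum_norm_le_of_mem_decaySet (hb : 0 < b) (hb1 : b < 1) {α : ℕ → ℂ}
    (hα : α ∈ decaySet b t M) (n : ℕ) : ∑ k ∈ Finset.range n, ‖α k‖ ≤ M / (1 - b) := by
  have hM := nonneg_of_mem_decaySet hα
  calc ∑ k ∈ Finset.range n, ‖α k‖ ≤ ∑ k ∈ Finset.range n, M * b ^ k :=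
        Finset.sum_le_sum fun k _ => (hα k).1
    _ ≤ ∑' k, M * b ^ k := by
        refine Summable.sum_le_tsum _ (fun k _ => by positivity)
          ((summable_geometric_of_lt_one hb.le hb1).mul_left M)
    _ = M / (1 - b) := by
        rw [tsum_mul_left, tsum_geometric_of_lt_one hb.le hb1, div_eq_mul_inv]

theorem norm_szegoSol_le_of_mem_decaySet (hb : 0 < b) (hb1 : b < 1) {α : ℕ → ℂ}
    (hα : α ∈ decaySet b t M) {z : ℂ} (hr : 1 ≤ r) (hz : ‖z‖ ≤ r) (w : ℂ × ℂ) (n : ℕ) :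
    ‖szegoSol α z w n‖ ≤ r ^ n * Real.exp (M / (1 - b)) * ‖w‖ := by
  refine (norm_szegoSol_le α hr hz w n).trans ?_
  gcongr
  exact sum_norm_le_of_mem_decaySet hb hb1 hα n

/-- A summable majorant of the series in `szegoCont`. -/
def szegoBound (b t r M : ℝ) (w : ℂ × ℂ) (n : ℕ) : ℝ :=
  (M * r * (r * t) ^ n + b * M ^ 2 * (r * b ^ 2) ^ n) * (Real.exp (M / (1 - b)) * ‖w‖)

theorem Rates.summable_szegoBound (h : Rates b t r) (M : ℝ) (w : ℂ × ℂ) :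
    Summable (szegoBound b t r M w) := by
  have hr := h.one_le
  have ht := h.t_nonneg
  refine Summable.mul_right _ (Summable.add ?_ ?_)
  · exact (summable_geometric_of_lt_one (by positivity) h.mul_t_lt_one).mul_left _
  · exact (summable_geometric_of_lt_one (by positivity) h.mul_sq_lt_one).mul_left _

theorem Rates.norm_szegoTerm_le (h : Rates b t r) {α : ℕ → ℂ} (hα : α ∈ decaySet b t M) {z : ℂ}
    (hz : ‖z‖ ≤ r) (w : ℂ × ℂ) (n : ℕ) :
    ‖szegoTerm b α z w n‖ ≤ szegoBound b t r M w n := by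
  have hM := nonneg_of_mem_decaySet hα
  have hb := h.b_pos
  have hr := h.one_le
  have ht := h.t_nonneg
  have h1 := (norm_fst_le _).trans
    (norm_szegoSol_le_of_mem_decaySet hb h.b_lt_one hα hr hz w (n + 1))
  have h2 := (norm_snd_le _).trans (norm_szegoSol_le_of_mem_decaySet hb h.b_lt_one hα hr hz w n)
  have h3 : ‖α n * conj (α n)‖ ≤ (M * b ^ n) ^ 2 := by
    rw [norm_mul, RCLike.norm_conj, ← sq]
    exact pow_le_pow_left₀ (norm_nonneg _) (hα n).1 2
  calc ‖szegoTerm b α z w n‖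
      ≤ ‖α (n + 1) - b * α n‖ * ‖(szegoSol α z w (n + 1)).1‖
        + b * ‖α n * conj (α n)‖ * ‖(szegoSol α z w n).2‖ := by
        refine (norm_sub_le _ _).trans_eq ?_
        rw [norm_mul, norm_mul, norm_mul (b : ℂ), Complex.norm_real, Real.norm_of_nonneg hb.le]
    _ ≤ M * t ^ n * (r ^ (n + 1) * Real.exp (M / (1 - b)) * ‖w‖)
        + b * (M * b ^ n) ^ 2 * (r ^ n * Real.exp (M / (1 - b)) * ‖w‖) := by
        gcongr
        exact (hα n).2
    _ = szegoBound b t r M w n := by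
        simp only [szegoBound, mul_pow]
        ring

theorem Rates.summable_szegoTerm (h : Rates b t r) {α : ℕ → ℂ} (hα : α ∈ decaySet b t M) {z : ℂ}
    (hz : ‖z‖ ≤ r) (w : ℂ × ℂ) : Summable (szegoTerm b α z w) :=
  Summable.of_norm_bounded (h.summable_szegoBound M w) (h.norm_szegoTerm_le hα hz w)

/-- Telescoping. Substituting `z u_n = u_{n+1} + conj α_n v_n` in the increment `b z² α_n u_n - z
α_{n+1} u_{n+1}` brings out the difference `α_{n+1} - b α_n`, in which the leading term `C b ^ n`
cancels. -/
theorem szego_partial_sum (b : ℝ) (α : ℕ → ℂ) (z : ℂ) (w : ℂ × ℂ) (n : ℕ) :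
    (1 - b * z) * (szegoSol α z w n).2 - z * α n * (szegoSol α z w n).1
      = (1 - b * z) * w.2 - z * (α 0 * w.1 + ∑ k ∈ Finset.range n, szegoTerm b α z w k) := by
  induction n with
  | zero => simp; ring
  | succ n ih =>
    rw [Finset.sum_range_succ, ← add_assoc, mul_add, ← sub_sub, ← ih, szegoTerm,
      szegoSol_succ_snd, szegoSol_succ_fst]
    ring

theorem Rates.tendsto_szegoCont (h : Rates b t r) {α : ℕ → ℂ} (hα : α ∈ decaySet b t M) {z : ℂ}
    (hz : ‖z‖ ≤ r) (w : ℂ × ℂ) :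
    Tendsto (fun n => (1 - b * z) * (szegoSol α z w n).2 - z * α n * (szegoSol α z w n).1) atTop
      (𝓝 (szegoCont b α z w)) := by
  simp only [szego_partial_sum]
  exact (((h.summable_szegoTerm hα hz w).hasSum.tendsto_sum_nat.const_add _).const_mul _).const_sub _

theorem shift_mem_decaySet (hb : 0 < b) (hb1 : b < 1) (ht : 0 ≤ t) (ht1 : t < 1) {α : ℕ → ℂ}
    (hα : α ∈ decaySet b t M) (N : ℕ) : (fun k => α (N + k)) ∈ decaySet b t M := by
  have hM := nonneg_of_mem_decaySet hα
  intro n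
  refine ⟨(hα (N + n)).1.trans ?_, (hα (N + n)).2.trans ?_⟩
  · exact mul_le_mul_of_nonneg_left (pow_le_pow_of_le_one hb.le hb1.le (by omega)) hM
  · exact mul_le_mul_of_nonneg_left (pow_le_pow_of_le_one ht ht1.le (by omega)) hM

theorem Rates.t_lt_one (h : Rates b t r) : t < 1 :=
  (le_mul_of_one_le_left h.t_nonneg h.one_le).trans_lt h.mul_t_lt_one

/-- The first `N` coefficients enter only through the pair they produce; this and linearity in the
initial pair isolate the effect of one coefficient. -/
theorem Rates.szegoCont_shift (h : Rates b t r) {α : ℕ → ℂ} (hα : α ∈ decaySet b t M) {z : ℂ}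
    (hz : ‖z‖ ≤ r) (w : ℂ × ℂ) (N : ℕ) :
    szegoCont b α z w = szegoCont b (fun k => α (N + k)) z (szegoSol α z w N) := by
  refine tendsto_nhds_unique
    ((tendsto_add_atTop_iff_nat N).2 (h.tendsto_szegoCont hα hz w)) ?_
  have := h.tendsto_szegoCont (shift_mem_decaySet h.b_pos h.b_lt_one h.t_nonneg h.t_lt_one hα N) hz
    (szegoSol α z w N)
  refine this.congr fun n => ?_
  rw [add_comm n N, szegoSol_add]

theorem Rates.szegoCont_linear (h : Rates b t r) {α : ℕ → ℂ} (hα : α ∈ decaySet b t M) {z : ℂ}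
    (hz : ‖z‖ ≤ r) (w : ℂ × ℂ) :
    szegoCont b α z w = w.1 * szegoCont b α z (1, 0) + w.2 * szegoCont b α z (0, 1) := by
  refine tendsto_nhds_unique (h.tendsto_szegoCont hα hz w) ?_
  refine (((h.tendsto_szegoCont hα hz (1, 0)).const_mul w.1).add
    ((h.tendsto_szegoCont hα hz (0, 1)).const_mul w.2)).congr fun n => ?_
  rw [szegoSol_linear α z w n]
  simp only [Prod.fst_add, Prod.snd_add, Prod.smul_fst, Prod.smul_snd, smul_eq_mul]
  ring

/-- The majorant `szegoBound` is uniform over `decaySet b t M`, so the product topology on sequences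
suffices: each term involves finitely many coefficients. -/
theorem Rates.continuousOn_szegoCont (h : Rates b t r) (M : ℝ) (w : ℂ × ℂ) :
    ContinuousOn (fun p : (ℕ → ℂ) × ℂ => szegoCont b p.1 p.2 w)
      (decaySet b t M ×ˢ Metric.closedBall 0 r) := by
  have h1 : ContinuousOn (fun p : (ℕ → ℂ) × ℂ => ∑' n, szegoTerm b p.1 p.2 w n)
      (decaySet b t M ×ˢ Metric.closedBall 0 r) := by
    refine continuousOn_tsum (fun n => ?_) (h.summable_szegoBound M w) fun n p hp =>
      h.norm_szegoTerm_le hp.1 (mem_closedBall_zero_iff.1 hp.2) w n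
    have h2 := continuous_szegoSol w n
    have h3 := continuous_szegoSol w (n + 1)
    simp only [szegoTerm]
    have h4 : ∀ k, Continuous fun p : (ℕ → ℂ) × ℂ => p.1 k := fun k => by fun_prop
    exact (((h4 _).sub (continuous_const.mul (h4 _))).mul h3.fst |>.sub
      ((continuous_const.mul ((h4 _).mul (Complex.continuous_conj.comp (h4 _)))).mul
        h2.snd)).continuousOn
  have h4 : Continuous fun p : (ℕ → ℂ) × ℂ => p.1 0 := by fun_prop
  simp only [szegoCont]
  exact ContinuousOn.sub (by fun_prop) (continuousOn_snd.mul
    ((h4.continuousOn.mul continuousOn_const).add h1))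

theorem Rates.differentiableOn_szegoCont (h : Rates b t r) {α : ℕ → ℂ} (hα : α ∈ decaySet b t M)
    (w : ℂ × ℂ) :
    DifferentiableOn ℂ (fun z => szegoCont b α z w) (Metric.ball 0 r) := by
  have h1 : DifferentiableOn ℂ (fun z => ∑' n, szegoTerm b α z w n) (Metric.ball 0 r) := by
    refine Complex.differentiableOn_tsum_of_summable_norm (h.summable_szegoBound M w) (fun n => ?_)
      Metric.isOpen_ball fun n z hz =>
        h.norm_szegoTerm_le hα (mem_ball_zero_iff.1 hz).le w n
    have h2 := (differentiable_szegoSol α w n).2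
    have h3 := (differentiable_szegoSol α w (n + 1)).1
    simp only [szegoTerm]
    exact Differentiable.differentiableOn (by fun_prop)
  simp only [szegoCont]
  fun_prop

/-- Inside the disk of radius `b⁻¹` the functions `Φ_n^*` converge. -/
theorem Rates.tendsto_snd_szegoSol (h : Rates b t r) {α : ℕ → ℂ} (hα : α ∈ decaySet b t M) {z : ℂ}
    (hz : ‖z‖ ≤ r) (hzb : ‖z‖ * b < 1) (w : ℂ × ℂ) :
    Tendsto (fun n => (szegoSol α z w n).2) atTop (𝓝 (szegoCont b α z w / (1 - b * z))) := by
  have hb := h.b_pos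
  have hne : 1 - b * z ≠ 0 := by
    intro h0
    have := congrArg norm (sub_eq_zero.1 h0)
    rw [norm_one, norm_mul, Complex.norm_real, Real.norm_of_nonneg hb.le] at this
    linarith
  set s := max 1 ‖z‖ with hs
  have hs1 : s * b < 1 := by
    rcases max_cases 1 ‖z‖ with ⟨h1, -⟩ | ⟨h1, -⟩ <;> rw [hs, h1]
    · simpa using h.b_lt_one
    · exact hzb
  have hs0 : 0 < s := lt_of_lt_of_le one_pos (le_max_left _ _)
  have hM := nonneg_of_mem_decaySet hα
  -- The correction term is `O((s b) ^ n)`, and `s b < 1` for `|z| < b⁻¹`.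
  have h1 : Tendsto (fun n => z * α n * (szegoSol α z w n).1) atTop (𝓝 0) := by
    refine squeeze_zero_norm (a := fun n => ‖z‖ * M * (Real.exp (M / (1 - b)) * ‖w‖) * (s * b) ^ n)
      (fun n => ?_) ?_
    · have h2 := (norm_fst_le _).trans (norm_szegoSol_le_of_mem_decaySet hb h.b_lt_one hα
        (le_max_left 1 ‖z‖) (le_max_right 1 ‖z‖) w n)
      rw [norm_mul, norm_mul]
      calc ‖z‖ * ‖α n‖ * ‖(szegoSol α z w n).1‖
          ≤ ‖z‖ * (M * b ^ n) * (s ^ n * Real.exp (M / (1 - b)) * ‖w‖) := by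
            gcongr
            exact (hα n).1
        _ = _ := by rw [mul_pow]; ring
    · simpa using (tendsto_pow_atTop_nhds_zero_of_lt_one (by positivity) hs1).const_mul
        (‖z‖ * M * (Real.exp (M / (1 - b)) * ‖w‖))
  have h2 := ((h.tendsto_szegoCont hα hz w).add h1).div_const (1 - b * z)
  simp only [sub_add_cancel, add_zero] at h2
  exact h2.congr fun n => mul_div_cancel_left₀ _ hne

/-- The point `b⁻¹` is a genuine pole of the limit of the `Φ_n^*`. -/
theorem Rates.szegoCont_inv_ne_zero (h : Rates b t r) {α : ℕ → ℂ} (hα : α ∈ decaySet b t M)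
    (h1 : ∀ j, ‖α j‖ < 1) (hr : b⁻¹ ≤ r) {c : ℝ} (hc : 0 < c)
    (hlow : ∀ᶠ n in atTop, c * b ^ n ≤ ‖α n‖) :
    szegoCont b α (b : ℂ)⁻¹ (1, 1) ≠ 0 := by
  have hb := h.b_pos
  have hbc : (b : ℂ) ≠ 0 := by exact_mod_cast hb.ne'
  have hnb : ‖(b : ℂ)⁻¹‖ = b⁻¹ := by
    rw [norm_inv, Complex.norm_real, Real.norm_of_nonneg hb.le]
  obtain ⟨δ, hδ, hlb⟩ := exists_le_norm_snd_szegoSol h1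
    (summable_norm_of_mem_decaySet hb h.b_lt_one hα)
  have hlim := (h.tendsto_szegoCont hα (z := (b : ℂ)⁻¹) (by rwa [hnb]) (1, 1)).norm
  -- At `b⁻¹` only `-z α_n u_n` survives. By reflection `|u_n(b⁻¹)| = b⁻ⁿ |Φ_n^*(b)| ≥ b⁻ⁿ δ`, which
  -- offsets the decay `c b ^ n` of `α_n`.
  have hge : b⁻¹ * c * δ ≤ ‖szegoCont b α (b : ℂ)⁻¹ (1, 1)‖ := by
    refine ge_of_tendsto hlim (hlow.mono fun n hn => ?_)
    rw [mul_inv_cancel₀ hbc, sub_self, zero_mul, zero_sub, norm_neg, norm_mul, norm_mul, hnb,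
      (szegoSol_reflect α (inv_ne_zero hbc) n).1, norm_mul, RCLike.norm_conj, norm_pow, hnb]
    have h3 : δ ≤ ‖(szegoSol α (conj (b : ℂ)⁻¹)⁻¹ (1, 1) n).2‖ := by
      refine hlb _ ?_ n
      rw [norm_inv, RCLike.norm_conj, hnb, inv_inv]
      exact h.b_lt_one.le
    calc b⁻¹ * c * δ = b⁻¹ * (c * b ^ n) * (b⁻¹ ^ n * δ) := by
          rw [inv_pow]; field_simp
      _ ≤ _ := by gcongr
  intro h0
  rw [h0, norm_zero] at hge
  exact absurd hge (not_le.2 (by positivity))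

/-! ### Arc length measure -/

instance : IsProbabilityMeasure arcMeasure := by
  refine ⟨?_⟩
  rw [arcMeasure, Measure.smul_apply, Measure.map_apply (by fun_prop) MeasurableSet.univ]
  simp only [preimage_univ, Measure.restrict_apply_univ, Real.volume_Ioc, sub_zero, smul_eq_mul]
  rw [← ENNReal.ofReal_mul (by positivity), one_div_mul_cancel (by positivity), ENNReal.ofReal_one]

theorem arcMeasure_compl_sphere : arcMeasure (Metric.sphere (0 : ℂ) 1)ᶜ = 0 := by
  rw [arcMeasure, Measure.smul_apply, Measure.map_apply (by fun_prop)
    Metric.isClosed_sphere.measurableSet.compl]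
  have : circleMap 0 1 ⁻¹' (Metric.sphere (0 : ℂ) 1)ᶜ = ∅ := by
    ext θ
    simp
  simp [this]

theorem arcMeasure_finite {s : Set ℂ} (hs : s.Finite) : arcMeasure s = 0 := by
  rw [arcMeasure, Measure.smul_apply, Measure.map_apply (by fun_prop) hs.measurableSet]
  simp [(hs.countable.preimage_circleMap 0 one_ne_zero).measure_zero
    (volume.restrict (Ioc (0 : ℝ) (2 * Real.pi)))]

theorem restrict_sphere_eq {μ : Measure ℂ} (hμ : μ (Metric.sphere (0 : ℂ) 1)ᶜ = 0) :
    μ.restrict (Metric.sphere (0 : ℂ) 1) = μ := by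
  rw [Measure.restrict_eq_self_of_ae_mem]
  exact mem_ae_iff.2 hμ

theorem integrable_of_continuousOn_sphere {E : Type*} [NormedAddCommGroup E]
    {μ : Measure ℂ} [IsFiniteMeasure μ]
    (hμ : μ (Metric.sphere (0 : ℂ) 1)ᶜ = 0) {f : ℂ → E}
    (hf : ContinuousOn f (Metric.sphere 0 1)) : Integrable f μ := by
  rw [← restrict_sphere_eq hμ]
  exact hf.integrableOn_compact (isCompact_sphere _ _)

theorem integral_arcMeasure {E : Type*} [NormedAddCommGroup E] [NormedSpace ℝ E]
    {f : ℂ → E} (hf : ContinuousOn f (Metric.sphere 0 1)) :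
    ∫ ζ, f ζ ∂arcMeasure = Real.circleAverage f 0 1 := by
  have h1 := (integrable_of_continuousOn_sphere arcMeasure_compl_sphere hf).aestronglyMeasurable
  have h2 : AEStronglyMeasurable f
      ((volume.restrict (Ioc (0 : ℝ) (2 * Real.pi))).map (circleMap 0 1)) := by
    refine h1.mono_ac ?_
    rw [arcMeasure]
    exact Measure.absolutelyContinuous_smul (by simp [Real.pi_pos])
  rw [arcMeasure, integral_smul_measure, integral_map (by fun_prop) h2, Real.circleAverage_def,
    intervalIntegral.integral_of_le (by positivity), ENNReal.toReal_ofReal (by positivity), one_div]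

theorem integral_arcMeasure_eq_eval_zero {f : ℂ → ℂ} (hf : DiffContOnCl ℂ f (Metric.ball 0 1)) :
    ∫ ζ, f ζ ∂arcMeasure = f 0 := by
  have hc : ContinuousOn f (Metric.closedBall 0 1) := by
    rw [← closure_ball (0 : ℂ) one_ne_zero]; exact hf.2
  rw [integral_arcMeasure (hc.mono Metric.sphere_subset_closedBall)]
  exact DiffContOnCl.circleAverage (by simpa using hf)

/-- **Schwarz integral formula.** A function `h` analytic in the disk with `h 0` real is determined
by the boundary values of its real part. -/
theorem integral_arcMeasure_schwarz {h : ℂ → ℂ} (hh : DiffContOnCl ℂ h (Metric.ball 0 1))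
    (h0 : conj (h 0) = h 0) {z : ℂ} (hz : z ∈ Metric.ball (0 : ℂ) 1) :
    ∫ ζ, (ζ + z) / (ζ - z) * ((h ζ).re : ℂ) ∂arcMeasure = h z := by
  have hz1 : ‖z‖ < 1 := mem_ball_zero_iff.1 hz
  have hc : ContinuousOn h (Metric.sphere 0 1) := by
    refine ContinuousOn.mono ?_ Metric.sphere_subset_closedBall
    rw [← closure_ball (0 : ℂ) one_ne_zero]; exact hh.2
  have hne : ∀ ζ ∈ Metric.sphere (0 : ℂ) 1, ζ - z ≠ 0 := by
    intro ζ hζ h1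
    rw [mem_sphere_zero_iff_norm, sub_eq_zero.1 h1] at hζ
    linarith
  have hne' : ∀ ζ ∈ Metric.closedBall (0 : ℂ) 1, 1 - conj z * ζ ≠ 0 := by
    intro ζ hζ h1
    have h2 := congrArg norm (sub_eq_zero.1 h1)
    rw [norm_one, norm_mul, RCLike.norm_conj] at h2
    have h3 := mul_le_mul_of_nonneg_left (mem_closedBall_zero_iff.1 hζ) (norm_nonneg z)
    linarith
  have hint : ∀ f : ℂ → ℂ, ContinuousOn f (Metric.sphere 0 1) → Integrable f arcMeasure :=
    fun f hf => integrable_of_continuousOn_sphere arcMeasure_compl_sphere hf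
  have c1 : ContinuousOn (fun ζ => ζ / (ζ - z) * h ζ) (Metric.sphere 0 1) :=
    (continuousOn_id.div (by fun_prop) hne).mul hc
  have e1 : ∫ ζ, ζ / (ζ - z) * h ζ ∂arcMeasure = h z := by
    rw [integral_arcMeasure c1]
    have := DiffContOnCl.circleAverage_smul_div (f := h) (c := 0) (R := 1) (w := z)
      (by simpa using hh) (by simpa using hz1)
    simpa using this
  have e2 : ∫ ζ, h ζ ∂arcMeasure = h 0 := integral_arcMeasure_eq_eval_zero hh
  have hd3 : DiffContOnCl ℂ (fun ζ => (1 + conj z * ζ) / (1 - conj z * ζ) * h ζ)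
      (Metric.ball 0 1) := by
    refine DiffContOnCl.smul (c := fun ζ => (1 + conj z * ζ) / (1 - conj z * ζ))
      (DifferentiableOn.diffContOnCl ?_) hh
    rw [closure_ball (0 : ℂ) one_ne_zero]
    exact DifferentiableOn.div (by fun_prop) (by fun_prop) hne'
  have e3 : ∫ ζ, (1 + conj z * ζ) / (1 - conj z * ζ) * h ζ ∂arcMeasure = h 0 := by
    rw [integral_arcMeasure_eq_eval_zero hd3]
    simp
  have e4 : ∫ ζ, conj ((1 + conj z * ζ) / (1 - conj z * ζ) * h ζ) ∂arcMeasure = h 0 := by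
    rw [integral_conj, e3, h0]
  -- Split `Re h = (h + conj h) / 2`. Against `h` the kernel is `2 ζ / (ζ - z) - 1`, handled by
  -- Cauchy's formula. Against `conj h` it is, on the circle, the conjugate of `(1 + conj z ζ) / (1
  -- - conj z ζ)`, which is analytic in the disk, so the mean value property applies.
  have hae : ∀ᵐ ζ ∂arcMeasure, (ζ + z) / (ζ - z) * ((h ζ).re : ℂ)
      = 1 / 2 * (2 * (ζ / (ζ - z) * h ζ) - h ζ
        + conj ((1 + conj z * ζ) / (1 - conj z * ζ) * h ζ)) := by
    filter_upwards [mem_ae_iff.2 arcMeasure_compl_sphere] with ζ hζ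
    have hζ1 : ‖ζ‖ = 1 := mem_sphere_zero_iff_norm.1 hζ
    have hζ0 : ζ ≠ 0 := by
      intro h; simp [h] at hζ1
    have hk := hne ζ hζ
    have hcj : conj ζ = ζ⁻¹ := by
      rw [Complex.inv_def, Complex.normSq_eq_norm_sq, hζ1]; simp
    have h1 : conj ((1 + conj z * ζ) / (1 - conj z * ζ)) = (ζ + z) / (ζ - z) := by
      simp only [map_div₀, map_add, map_sub, map_mul, map_one, Complex.conj_conj, hcj]
      field_simp
    rw [map_mul, h1, Complex.re_eq_add_conj]
    field_simp
    ring
  have i1 : Integrable (fun ζ => 2 * (ζ / (ζ - z) * h ζ)) arcMeasure := (hint _ c1).const_mul 2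
  have i2 : Integrable (fun ζ => 2 * (ζ / (ζ - z) * h ζ) - h ζ) arcMeasure := i1.sub (hint h hc)
  have i3 : Integrable (fun ζ => conj ((1 + conj z * ζ) / (1 - conj z * ζ) * h ζ)) arcMeasure := by
    refine hint _ (Complex.continuous_conj.comp_continuousOn ?_)
    refine ContinuousOn.mono ?_ Metric.sphere_subset_closedBall
    rw [← closure_ball (0 : ℂ) one_ne_zero]; exact hd3.2
  rw [integral_congr_ae hae, integral_const_mul, integral_add i2 i3,
    integral_sub i1 (hint h hc), integral_const_mul, e1, e2, e4]
  ring

/-! ### Measures on the circle are determined by their moments -/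

/-- Two finite measures on the unit circle with the same moments `∫ z ^ n`, `n ≥ 0`, agree. -/
theorem eq_of_moments_eq {μ ν : Measure ℂ} [IsFiniteMeasure μ] [IsFiniteMeasure ν]
    (hμ : μ (Metric.sphere (0 : ℂ) 1)ᶜ = 0) (hν : ν (Metric.sphere (0 : ℂ) 1)ᶜ = 0)
    (h : ∀ n : ℕ, ∫ z, z ^ n ∂μ = ∫ z, z ^ n ∂ν) : μ = ν := by
  let S := Metric.sphere (0 : ℂ) 1
  have hS : MeasurableSet S := Metric.isClosed_sphere.measurableSet
  have hsup : ∀ {ρ : Measure ℂ}, ρ Sᶜ = 0 → (ρ.comap ((↑) : S → ℂ)).map (↑) = ρ := by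
    intro ρ hρ
    rw [map_comap_subtype_coe hS, restrict_sphere_eq hρ]
  have hintS : ∀ {ρ : Measure ℂ}, ρ Sᶜ = 0 → ∀ f : ℂ → ℂ,
      ∫ x : S, f x ∂(ρ.comap ((↑) : S → ℂ)) = ∫ x, f x ∂ρ := by
    intro ρ hρ f
    conv_rhs => rw [← hsup hρ]
    rw [(MeasurableEmbedding.subtype_coe hS).integral_map]
  have hfin : ∀ {ρ : Measure ℂ} [IsFiniteMeasure ρ],
      IsFiniteMeasure (ρ.comap ((↑) : S → ℂ)) := by
    intro ρ _
    refine ⟨?_⟩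
    rw [comap_subtype_coe_apply hS]
    exact measure_lt_top _ _
  -- On the circle every monomial in `z` and `conj z` is a power of `z` or the conjugate of one, so
  -- moments with `n ≥ 0` control the star algebra generated by `z`, which separates points.
  have hneg : ∀ m n : ℕ, ∀ x : S, ((x : ℂ) ^ m * conj (x : ℂ) ^ n)
      = if n ≤ m then (x : ℂ) ^ (m - n) else conj ((x : ℂ) ^ (n - m)) := by
    intro m n x
    have hx : (x : ℂ) * conj (x : ℂ) = 1 := by
      rw [Complex.mul_conj, Complex.normSq_eq_norm_sq, mem_sphere_zero_iff_norm.1 x.2]; simp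
    split_ifs with hnm
    · obtain ⟨k, rfl⟩ := Nat.exists_eq_add_of_le hnm
      rw [pow_add, mul_right_comm, ← mul_pow, hx]
      simp
    · obtain ⟨k, rfl⟩ := Nat.exists_eq_add_of_le (not_le.1 hnm).le
      rw [pow_add, ← mul_assoc, ← mul_pow, hx]
      simp
  have hmn : ∀ {ρ : Measure ℂ}, ρ Sᶜ = 0 → ∀ m n : ℕ,
      ∫ x : S, ((x : ℂ) ^ m * conj (x : ℂ) ^ n) ∂(ρ.comap ((↑) : S → ℂ))
        = if n ≤ m then ∫ x, x ^ (m - n) ∂ρ else conj (∫ x, x ^ (n - m) ∂ρ) := by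
    intro ρ hρ m n
    simp only [hneg]
    split_ifs
    · exact hintS hρ fun x => x ^ (m - n)
    · rw [← integral_conj]
      exact hintS hρ fun x => conj (x ^ (n - m))
  let g : BoundedContinuousFunction S ℂ :=
    BoundedContinuousFunction.mkOfCompact ⟨fun x => (x : ℂ), continuous_subtype_val⟩
  let A : StarSubalgebra ℂ (BoundedContinuousFunction S ℂ) := StarAlgebra.adjoin ℂ {g}
  have := hfin (ρ := μ)
  have := hfin (ρ := ν)
  have key : μ.comap ((↑) : S → ℂ) = ν.comap ((↑) : S → ℂ) := by
    refine ext_of_forall_mem_subalgebra_integral_eq_of_pseudoEMetric_complete_countable (𝕜 := ℂ)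
      (A := A) ?_ ?_
    · intro x y hxy
      refine ⟨_, ⟨_, StarSubalgebra.mem_map.2 ⟨g, StarAlgebra.subset_adjoin ℂ _ rfl, rfl⟩, rfl⟩, ?_⟩
      exact fun h => hxy (Subtype.ext h)
    · intro f hf
      have hf' : f ∈ Algebra.adjoin ℂ ({g} ∪ star {g}) := hf
      rw [← Subalgebra.mem_toSubmodule, Algebra.adjoin_eq_span] at hf'
      clear hf
      induction hf' using Submodule.span_induction with
      | mem f hf =>
        rw [Set.star_singleton, Set.singleton_union] at hf
        obtain ⟨m, n, rfl⟩ := (Submonoid.mem_closure_pair _ _ _).1 hf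
        have e : ∀ x, (g ^ m * star g ^ n) x = (x : ℂ) ^ m * conj (x : ℂ) ^ n := fun x => rfl
        simp only [e, hmn hμ, hmn hν, h]
      | zero => simp
      | add f₁ f₂ _ _ h₁ h₂ =>
        simp only [BoundedContinuousFunction.add_apply]
        rw [integral_add (f₁.integrable _) (f₂.integrable _),
          integral_add (f₁.integrable _) (f₂.integrable _), h₁, h₂]
      | smul c f _ hf =>
        simp only [BoundedContinuousFunction.smul_apply]
        rw [integral_smul, integral_smul, hf]
  rw [← hsup hμ, ← hsup hν, key]

/-! ### The polynomials generated by the Szegő recursion -/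

/-- The pair `(Φ_n, Φ_n^*)` generated by the Szegő recursion. -/
def szegoPoly (α : ℕ → ℂ) : ℕ → ℂ[X] × ℂ[X]
  | 0 => (1, 1)
  | n + 1 => (X * (szegoPoly α n).1 - C (conj (α n)) * (szegoPoly α n).2,
      (szegoPoly α n).2 - C (α n) * X * (szegoPoly α n).1)

theorem eval_szegoPoly (α : ℕ → ℂ) (z : ℂ) (n : ℕ) :
    (szegoPoly α n).1.eval z = (szegoSol α z (1, 1) n).1 ∧
      (szegoPoly α n).2.eval z = (szegoSol α z (1, 1) n).2 := by
  induction n with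
  | zero => simp [szegoPoly]
  | succ n ih => simp [szegoPoly, szegoSol_succ_fst, szegoSol_succ_snd, ih.1, ih.2]

theorem szegoSol_zero_snd (α : ℕ → ℂ) (w : ℂ × ℂ) (n : ℕ) : (szegoSol α 0 w n).2 = w.2 := by
  induction n with
  | zero => simp
  | succ n ih => simp [szegoSol_succ_snd, ih]

theorem degree_szegoPoly (α : ℕ → ℂ) (n : ℕ) :
    (szegoPoly α n).1.Monic ∧ (szegoPoly α n).1.natDegree = n ∧
      (szegoPoly α n).2.natDegree ≤ n := by
  induction n with
  | zero => simp [szegoPoly]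
  | succ n ih =>
    obtain ⟨h1, h2, h3⟩ := ih
    have hm : (X * (szegoPoly α n).1).Monic := monic_X.mul h1
    have hd : (X * (szegoPoly α n).1).natDegree = n + 1 := by
      rw [natDegree_X_mul h1.ne_zero, h2]
    have hlt : (C (conj (α n)) * (szegoPoly α n).2).natDegree < n + 1 :=
      ((natDegree_C_mul_le _ _).trans h3).trans_lt (Nat.lt_succ_self n)
    have hlt' : (C (conj (α n)) * (szegoPoly α n).2).degree < (X * (szegoPoly α n).1).degree :=
      degree_lt_degree (by rwa [hd])
    refine ⟨hm.sub_of_left hlt', ?_, ?_⟩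
    · rw [szegoPoly, natDegree_sub_eq_left_of_natDegree_lt (by rwa [hd]), hd]
    · rw [szegoPoly]
      refine (natDegree_sub_le _ _).trans (max_le (h3.trans n.le_succ) ?_)
      rw [mul_assoc]
      exact (natDegree_C_mul_le _ _).trans hd.le

theorem neg_conj_eval_zero_szegoPoly (α : ℕ → ℂ) (n : ℕ) :
    α n = -conj ((szegoPoly α (n + 1)).1.eval 0) := by
  rw [(eval_szegoPoly α 0 (n + 1)).1, szegoSol_succ_fst, szegoSol_zero_snd]
  simp

/-! ### Orthogonality -/

theorem conj_eq_inv_of_mem_sphere {ζ : ℂ} (hζ : ζ ∈ Metric.sphere (0 : ℂ) 1) : conj ζ = ζ⁻¹ := by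
  rw [Complex.inv_def, Complex.normSq_eq_norm_sq, mem_sphere_zero_iff_norm.1 hζ]; simp

theorem ne_zero_of_mem_sphere {ζ : ℂ} (hζ : ζ ∈ Metric.sphere (0 : ℂ) 1) : ζ ≠ 0 := by
  rintro rfl
  simp at hζ

theorem szegoSol_fst_eq_on_sphere (α : ℕ → ℂ) {ζ : ℂ} (hζ : ζ ∈ Metric.sphere (0 : ℂ) 1) (n : ℕ) :
    (szegoSol α ζ (1, 1) n).1 = ζ ^ n * conj (szegoSol α ζ (1, 1) n).2 := by
  have := (szegoSol_reflect α (ne_zero_of_mem_sphere hζ) n).1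
  rwa [conj_eq_inv_of_mem_sphere hζ, inv_inv] at this

theorem continuous_szegoSol_snd (α : ℕ → ℂ) (w : ℂ × ℂ) (n : ℕ) :
    Continuous fun z => (szegoSol α z w n).2 := (differentiable_szegoSol α w n).2.continuous

theorem continuous_szegoSol_fst (α : ℕ → ℂ) (w : ℂ × ℂ) (n : ℕ) :
    Continuous fun z => (szegoSol α z w n).1 := (differentiable_szegoSol α w n).1.continuous

/-- `Φ_n` is orthogonal to `1, …, z ^ (n - 1)` and `Φ_n^*` to `z, …, z ^ n`. -/
def IsSzegoOrthogonal (μ : Measure ℂ) (α : ℕ → ℂ) (n : ℕ) : Prop :=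
  (∀ k < n, ∫ z, conj (z ^ k) * (szegoSol α z (1, 1) n).1 ∂μ = 0) ∧
    ∀ k, 1 ≤ k → k ≤ n → ∫ z, conj (z ^ k) * (szegoSol α z (1, 1) n).2 ∂μ = 0

/-- By reflection on the circle, `conj (z ^ k) Φ_n^*` is the conjugate of `conj (z ^ (n - k)) Φ_n`.
-/
theorem isSzegoOrthogonal_of_fst {μ : Measure ℂ} (hμ : μ (Metric.sphere (0 : ℂ) 1)ᶜ = 0)
    {α : ℕ → ℂ} {n : ℕ} (h : ∀ k < n, ∫ z, conj (z ^ k) * (szegoSol α z (1, 1) n).1 ∂μ = 0) :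
    IsSzegoOrthogonal μ α n := by
  refine ⟨h, fun k hk1 hkn => ?_⟩
  have h1 := congrArg conj (h (n - k) (by omega))
  rw [← integral_conj, map_zero] at h1
  rw [← h1]
  refine integral_congr_ae ?_
  filter_upwards [mem_ae_iff.2 hμ] with ζ hζ
  have h0 := ne_zero_of_mem_sphere hζ
  rw [szegoSol_fst_eq_on_sphere α hζ]
  simp only [map_mul, map_pow, Complex.conj_conj]
  rw [← mul_assoc, conj_eq_inv_of_mem_sphere hζ]
  congr 1
  obtain ⟨m, rfl⟩ := Nat.exists_eq_add_of_le hkn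
  rw [Nat.add_sub_cancel_left, pow_add, mul_left_comm, ← mul_pow, mul_inv_cancel₀ h0, one_pow,
    mul_one]

/-- Orthogonality passes from `n + 1` to `n` along the inverse Szegő recursion. -/
theorem IsSzegoOrthogonal.of_succ {μ : Measure ℂ} [IsFiniteMeasure μ]
    (hμ : μ (Metric.sphere (0 : ℂ) 1)ᶜ = 0) {α : ℕ → ℂ} (hα : ∀ j, ‖α j‖ < 1) {n : ℕ}
    (h : IsSzegoOrthogonal μ α (n + 1)) :
    IsSzegoOrthogonal μ α n ∧ ((1 - ‖α n‖ ^ 2 : ℝ) : ℂ) * ∫ z, (szegoSol α z (1, 1) n).2 ∂μ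
      = ∫ z, (szegoSol α z (1, 1) (n + 1)).2 ∂μ := by
  have hρ : ((1 - ‖α n‖ ^ 2 : ℝ) : ℂ) ≠ 0 := by
    have : ‖α n‖ ^ 2 < 1 := pow_lt_one₀ (norm_nonneg _) (hα n) two_ne_zero
    exact_mod_cast (sub_pos.2 this).ne'
  have hρ' : ((1 - ‖α n‖ ^ 2 : ℝ) : ℂ) = 1 - α n * conj (α n) := by
    rw [Complex.mul_conj, Complex.normSq_eq_norm_sq]; push_cast; rfl
  have hint : ∀ f : ℂ → ℂ, Continuous f → Integrable f μ :=
    fun f hf => integrable_of_continuousOn_sphere hμ hf.continuousOn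
  have hcu := continuous_szegoSol_fst α (1, 1)
  have hcv := continuous_szegoSol_snd α (1, 1)
  have hiu : ∀ k, Integrable (fun z => conj (z ^ k) * (szegoSol α z (1, 1) (n + 1)).1) μ :=
    fun k => hint _ ((Complex.continuous_conj.comp (by fun_prop)).mul (hcu _))
  have hiv : ∀ k, Integrable (fun z => conj (z ^ k) * (szegoSol α z (1, 1) (n + 1)).2) μ :=
    fun k => hint _ ((Complex.continuous_conj.comp (by fun_prop)).mul (hcv _))
  -- The inverse recursion: `(1 - |α_n|²) v_n = v_{n+1} + α_n u_{n+1}`, and for `hu`, `(1 - |α_n|²)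
  -- z u_n = u_{n+1} + conj α_n v_{n+1}`. The factor `z` shifts `k` to `k + 1`.
  have hv : ∀ k, ((1 - ‖α n‖ ^ 2 : ℝ) : ℂ) * ∫ z, conj (z ^ k) * (szegoSol α z (1, 1) n).2 ∂μ
      = ∫ z, conj (z ^ k) * (szegoSol α z (1, 1) (n + 1)).2 ∂μ
        + α n * ∫ z, conj (z ^ k) * (szegoSol α z (1, 1) (n + 1)).1 ∂μ := by
    intro k
    rw [← integral_const_mul, ← integral_const_mul, ← integral_add (hiv k) ((hiu k).const_mul _)]
    congr 1 with z
    rw [szegoSol_succ_fst, szegoSol_succ_snd, hρ']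
    ring
  have hu : ∀ k, ((1 - ‖α n‖ ^ 2 : ℝ) : ℂ) * ∫ z, conj (z ^ k) * (szegoSol α z (1, 1) n).1 ∂μ
      = ∫ z, conj (z ^ (k + 1)) * (szegoSol α z (1, 1) (n + 1)).1 ∂μ
        + conj (α n) * ∫ z, conj (z ^ (k + 1)) * (szegoSol α z (1, 1) (n + 1)).2 ∂μ := by
    intro k
    rw [← integral_const_mul, ← integral_const_mul,
      ← integral_add (hiu _) ((hiv _).const_mul _)]
    refine integral_congr_ae ?_
    filter_upwards [mem_ae_iff.2 hμ] with ζ hζ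
    have h0 := ne_zero_of_mem_sphere hζ
    rw [szegoSol_succ_fst, szegoSol_succ_snd, hρ']
    simp only [map_pow, conj_eq_inv_of_mem_sphere hζ]
    have h1 : ζ⁻¹ ^ (k + 1) * ζ = ζ⁻¹ ^ k := by
      rw [pow_succ, mul_assoc, inv_mul_cancel₀ h0, mul_one]
    linear_combination -(1 - α n * conj (α n)) * (szegoSol α ζ (1, 1) n).1 * h1
  refine ⟨⟨fun k hk => ?_, fun k hk hkn => ?_⟩, ?_⟩
  · refine (mul_eq_zero.1 ?_).resolve_left hρ
    rw [hu, h.1 _ (by omega), h.2 _ (by omega) (by omega)]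
    simp
  · refine (mul_eq_zero.1 ?_).resolve_left hρ
    rw [hv, h.1 _ (by omega), h.2 _ hk (by omega)]
    simp
  · have := hv 0
    rw [h.1 _ (by omega)] at this
    simpa using this

theorem IsSzegoOrthogonal.of_le {μ : Measure ℂ} [IsFiniteMeasure μ]
    (hμ : μ (Metric.sphere (0 : ℂ) 1)ᶜ = 0) {α : ℕ → ℂ} (hα : ∀ j, ‖α j‖ < 1) {n m : ℕ}
    (hnm : n ≤ m) (h : IsSzegoOrthogonal μ α m) : IsSzegoOrthogonal μ α n := by
  induction m, hnm using Nat.le_induction with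
  | base => exact h
  | succ m _ ih => exact ih (h.of_succ hμ hα).1

/-- Gives the total mass of the unnormalized Bernstein–Szegő measures, for which the right-hand side
is `1`. -/
theorem IsSzegoOrthogonal.prod_mul_measure {μ : Measure ℂ} [IsFiniteMeasure μ]
    (hμ : μ (Metric.sphere (0 : ℂ) 1)ᶜ = 0) {α : ℕ → ℂ} (hα : ∀ j, ‖α j‖ < 1) {m : ℕ}
    (h : IsSzegoOrthogonal μ α m) :
    ((∏ k ∈ Finset.range m, (1 - ‖α k‖ ^ 2) : ℝ) : ℂ) * ∫ _, (1 : ℂ) ∂μ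
      = ∫ z, (szegoSol α z (1, 1) m).2 ∂μ := by
  induction m with
  | zero => simp
  | succ m ih =>
    obtain ⟨h1, h2⟩ := h.of_succ hμ hα
    rw [← h2, ← ih h1, Finset.prod_range_succ, Complex.ofReal_mul]
    ring

/-! ### Measures with a continuous density -/

/-- The measure `g dθ / 2π`. -/
def densityMeasure (g : ℂ → ℝ) : Measure ℂ :=
  arcMeasure.withDensity fun ζ => ENNReal.ofReal (g ζ)

section Density

variable {g : ℂ → ℝ}

theorem densityMeasure_compl_sphere (g : ℂ → ℝ) :
    densityMeasure g (Metric.sphere (0 : ℂ) 1)ᶜ = 0 :=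
  withDensity_absolutelyContinuous _ _ arcMeasure_compl_sphere

theorem aemeasurable_of_continuousOn_sphere (hg : ContinuousOn g (Metric.sphere 0 1)) :
    AEMeasurable g arcMeasure :=
  (integrable_of_continuousOn_sphere arcMeasure_compl_sphere hg).aemeasurable

theorem isFiniteMeasure_densityMeasure (hg : ContinuousOn g (Metric.sphere 0 1)) :
    IsFiniteMeasure (densityMeasure g) :=
  isFiniteMeasure_withDensity_ofReal
    (integrable_of_continuousOn_sphere arcMeasure_compl_sphere hg).2

theorem integral_densityMeasure (hg : ContinuousOn g (Metric.sphere 0 1))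
    (hg0 : ∀ ζ ∈ Metric.sphere (0 : ℂ) 1, 0 ≤ g ζ) (f : ℂ → ℂ) :
    ∫ ζ, f ζ ∂densityMeasure g = ∫ ζ, (g ζ : ℂ) * f ζ ∂arcMeasure := by
  rw [densityMeasure, integral_withDensity_eq_integral_toReal_smul₀
    (aemeasurable_of_continuousOn_sphere hg).ennreal_ofReal (ae_of_all _ fun _ => by simp)]
  refine integral_congr_ae ?_
  filter_upwards [mem_ae_iff.2 arcMeasure_compl_sphere] with ζ hζ
  rw [ENNReal.toReal_ofReal (hg0 ζ hζ), Complex.real_smul]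

theorem weight_densityMeasure (hg : ContinuousOn g (Metric.sphere 0 1))
    (hg0 : ∀ ζ ∈ Metric.sphere (0 : ℂ) 1, 0 ≤ g ζ) :
    weight (densityMeasure g) =ᵐ[arcMeasure] g := by
  filter_upwards [mem_ae_iff.2 arcMeasure_compl_sphere, Measure.rnDeriv_withDensity₀ arcMeasure
    (aemeasurable_of_continuousOn_sphere hg).ennreal_ofReal] with ζ hζ h
  rw [weight, densityMeasure, h, ENNReal.toReal_ofReal (hg0 ζ hζ)]

theorem isNontrivialCircleMeasure_densityMeasure (hg : ContinuousOn g (Metric.sphere 0 1))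
    (hg0 : ∀ ζ ∈ Metric.sphere (0 : ℂ) 1, 0 ≤ g ζ)
    (hg1 : ∫ ζ, (g ζ : ℂ) ∂arcMeasure = 1) : IsNontrivialCircleMeasure (densityMeasure g) := by
  have hfin := isFiniteMeasure_densityMeasure hg
  have h1 : (densityMeasure g).real univ = 1 := by
    have := integral_densityMeasure hg hg0 fun _ => 1
    simp only [mul_one, hg1, integral_const, Complex.real_smul] at this
    exact_mod_cast this
  have hprob : IsProbabilityMeasure (densityMeasure g) := by
    refine ⟨?_⟩
    rw [← ENNReal.toReal_eq_one_iff]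
    exact h1
  refine ⟨hprob, densityMeasure_compl_sphere g, fun s hs h0 => ?_⟩
  have h2 : densityMeasure g s = 0 :=
    withDensity_absolutelyContinuous _ _ (arcMeasure_finite hs)
  have h3 := measure_univ_le_add_compl (μ := densityMeasure g) s
  rw [h0, h2, measure_univ] at h3
  simp at h3

theorem szegoCondition_densityMeasure (hg : ContinuousOn g (Metric.sphere 0 1))
    (hg0 : ∀ ζ ∈ Metric.sphere (0 : ℂ) 1, 0 < g ζ) : SzegoCondition (densityMeasure g) := by
  have hw := weight_densityMeasure hg fun ζ hζ => (hg0 ζ hζ).le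
  constructor
  · filter_upwards [mem_ae_iff.2 arcMeasure_compl_sphere, hw] with ζ hζ h
    rw [h]
    exact hg0 ζ hζ
  · have h1 : Integrable (fun ζ => Real.log (g ζ)) arcMeasure :=
      integrable_of_continuousOn_sphere arcMeasure_compl_sphere
        (hg.log fun ζ hζ => (hg0 ζ hζ).ne')
    refine h1.congr ?_
    filter_upwards [hw] with ζ h
    rw [h]

end Density

/-! ### Existence: the Bernstein–Szegő measures and their limit -/

theorem szegoSol_snd_ne_zero {α : ℕ → ℂ} (hα : ∀ j, ‖α j‖ < 1) {z : ℂ} (hz : ‖z‖ ≤ 1) (n : ℕ) :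
    (szegoSol α z (1, 1) n).2 ≠ 0 := by
  induction n with
  | zero => simp
  | succ n ih =>
    intro h0
    rw [szegoSol_succ_snd, sub_eq_zero] at h0
    have h1 := congrArg norm h0
    rw [norm_mul, norm_mul] at h1
    have h2 := norm_fst_le_norm_snd_szegoSol hα hz n
    have h3 : ‖α n‖ * ‖z‖ * ‖(szegoSol α z (1, 1) n).1‖
        ≤ ‖α n‖ * 1 * ‖(szegoSol α z (1, 1) n).2‖ := by gcongr
    have h4 := norm_pos_iff.2 ih
    nlinarith [hα n]

/-- The Bernstein–Szegő density `|Φ_n^*|⁻²`. -/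
def bernsteinSzegoDensity (α : ℕ → ℂ) (n : ℕ) (ζ : ℂ) : ℝ :=
  (Complex.normSq (szegoSol α ζ (1, 1) n).2)⁻¹

theorem bernsteinSzegoDensity_nonneg (α : ℕ → ℂ) (n : ℕ) (ζ : ℂ) :
    0 ≤ bernsteinSzegoDensity α n ζ := inv_nonneg.2 (Complex.normSq_nonneg _)

theorem continuousOn_bernsteinSzegoDensity {α : ℕ → ℂ} (hα : ∀ j, ‖α j‖ < 1) (n : ℕ) :
    ContinuousOn (bernsteinSzegoDensity α n) (Metric.sphere 0 1) :=
  ContinuousOn.inv₀ (Complex.continuous_normSq.comp (continuous_szegoSol_snd α _ n)).continuousOn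
    fun _ hζ => (_root_.map_ne_zero _).2 (szegoSol_snd_ne_zero hα (mem_sphere_zero_iff_norm.1 hζ).le n)

theorem ofReal_inv_normSq (w : ℂ) : (((Complex.normSq w)⁻¹ : ℝ) : ℂ) = w⁻¹ * (conj w)⁻¹ := by
  rw [Complex.ofReal_inv, ← Complex.mul_conj, mul_inv]

theorem diffContOnCl_pow_mul_inv {α : ℕ → ℂ} (hα : ∀ j, ‖α j‖ < 1) (k n : ℕ) :
    DiffContOnCl ℂ (fun ζ => ζ ^ k * (szegoSol α ζ (1, 1) n).2⁻¹) (Metric.ball 0 1) := by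
  refine DifferentiableOn.diffContOnCl ?_
  rw [closure_ball (0 : ℂ) one_ne_zero]
  exact DifferentiableOn.mul (by fun_prop) ((differentiable_szegoSol α _ n).2.differentiableOn.inv
    fun ζ hζ => szegoSol_snd_ne_zero hα (mem_closedBall_zero_iff.1 hζ) n)

/-- On the circle `conj (z ^ k) Φ_n |Φ_n^*|⁻² = z ^ (n - k) / Φ_n^*`, which is analytic in the disk
and vanishes at `0` for `k < n`. The second integral is the conjugate of that of `1 / Φ_n^*`, with
value `1` at `0`. -/
theorem isSzegoOrthogonal_bernsteinSzego {α : ℕ → ℂ} (hα : ∀ j, ‖α j‖ < 1) (n : ℕ) :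
    IsSzegoOrthogonal (densityMeasure (bernsteinSzegoDensity α n)) α n ∧
      ∫ z, (szegoSol α z (1, 1) n).2 ∂densityMeasure (bernsteinSzegoDensity α n) = 1 := by
  have hg := continuousOn_bernsteinSzegoDensity hα n
  have hg0 : ∀ ζ ∈ Metric.sphere (0 : ℂ) 1, 0 ≤ bernsteinSzegoDensity α n ζ :=
    fun ζ _ => bernsteinSzegoDensity_nonneg α n ζ
  have hval : ∀ k, ∫ ζ, ζ ^ k * (szegoSol α ζ (1, 1) n).2⁻¹ ∂arcMeasure = (0 : ℂ) ^ k := by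
    intro k
    rw [integral_arcMeasure_eq_eval_zero (diffContOnCl_pow_mul_inv hα k n), szegoSol_zero_snd]
    simp
  constructor
  · refine isSzegoOrthogonal_of_fst (densityMeasure_compl_sphere _) fun k hk => ?_
    have h0 := hval (n - k)
    rw [zero_pow (by omega)] at h0
    rw [integral_densityMeasure hg hg0, ← h0]
    refine integral_congr_ae ?_
    filter_upwards [mem_ae_iff.2 arcMeasure_compl_sphere] with ζ hζ
    have hζ0 := ne_zero_of_mem_sphere hζ
    have hv : conj (szegoSol α ζ (1, 1) n).2 ≠ 0 :=
      (_root_.map_ne_zero _).2 (szegoSol_snd_ne_zero hα (mem_sphere_zero_iff_norm.1 hζ).le n)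
    have hpow : ζ⁻¹ ^ k * ζ ^ n = ζ ^ (n - k) := by
      obtain ⟨m, rfl⟩ := Nat.exists_eq_add_of_le hk.le
      rw [Nat.add_sub_cancel_left, pow_add, ← mul_assoc, ← mul_pow, inv_mul_cancel₀ hζ0, one_pow,
        one_mul]
    rw [bernsteinSzegoDensity, ofReal_inv_normSq, szegoSol_fst_eq_on_sphere α hζ, map_pow,
      conj_eq_inv_of_mem_sphere hζ, ← hpow]
    field_simp
  · have h0 := congrArg conj (hval 0)
    rw [← integral_conj] at h0
    rw [integral_densityMeasure hg hg0]
    simp only [pow_zero, one_mul, map_one] at h0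
    refine Eq.trans (integral_congr_ae ?_) h0
    filter_upwards [mem_ae_iff.2 arcMeasure_compl_sphere] with ζ hζ
    have hv := szegoSol_snd_ne_zero hα (mem_sphere_zero_iff_norm.1 hζ).le n
    rw [bernsteinSzegoDensity, ofReal_inv_normSq, map_inv₀]
    field_simp

/-! ### The limit measure and its Szegő function -/

/-- The limit density `p |F|⁻²`, where `F` is the limit of `Φ_n^*`. -/
def limitDensity (p : ℝ) (F : ℂ → ℂ) (ζ : ℂ) : ℝ := p * (Complex.normSq (F ζ))⁻¹

/-- `F` is the limit of `Φ_n^*` on the closed unit disk and `p` that of `∏ (1 - |α_k|²)`. -/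
structure IsSzegoLimit (α : ℕ → ℂ) (p : ℝ) (F : ℂ → ℂ) : Prop where
  norm_lt_one : ∀ j, ‖α j‖ < 1
  summable : Summable fun j => ‖α j‖
  p_pos : 0 < p
  tendsto_prod : Tendsto (fun n => ∏ k ∈ Finset.range n, (1 - ‖α k‖ ^ 2)) atTop (𝓝 p)
  tendsto_snd : ∀ z : ℂ, ‖z‖ ≤ 1 → Tendsto (fun n => (szegoSol α z (1, 1) n).2) atTop (𝓝 (F z))
  continuousOn : ContinuousOn F (Metric.closedBall 0 1)

namespace IsSzegoLimit

variable {α : ℕ → ℂ} {p : ℝ} {F : ℂ → ℂ}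

theorem ne_zero (h : IsSzegoLimit α p F) {z : ℂ} (hz : ‖z‖ ≤ 1) : F z ≠ 0 := by
  obtain ⟨δ, hδ, hle⟩ := exists_le_norm_snd_szegoSol h.norm_lt_one h.summable
  have := ge_of_tendsto' (h.tendsto_snd z hz).norm (hle z hz)
  exact norm_pos_iff.1 (hδ.trans_le this)

theorem apply_zero (h : IsSzegoLimit α p F) : F 0 = 1 := by
  refine tendsto_nhds_unique (h.tendsto_snd 0 (by simp)) ?_
  simp only [szegoSol_zero_snd]
  exact tendsto_const_nhds

theorem density_pos (h : IsSzegoLimit α p F) :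
    ∀ ζ ∈ Metric.sphere (0 : ℂ) 1, 0 < limitDensity p F ζ := fun _ hζ =>
  mul_pos h.p_pos (inv_pos.2 (Complex.normSq_pos.2 (h.ne_zero (mem_sphere_zero_iff_norm.1 hζ).le)))

theorem continuousOn_density (h : IsSzegoLimit α p F) :
    ContinuousOn (limitDensity p F) (Metric.sphere 0 1) := by
  refine continuousOn_const.mul (ContinuousOn.inv₀ (Complex.continuous_normSq.comp_continuousOn
    (h.continuousOn.mono Metric.sphere_subset_closedBall)) fun ζ hζ => ?_)
  exact (_root_.map_ne_zero _).2 (h.ne_zero (mem_sphere_zero_iff_norm.1 hζ).le)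

/-- Dominated convergence: the lower bound `δ` on `|Φ_m^*|` bounds all densities by `δ⁻²`. The
product normalizes the measures. -/
theorem tendsto_integral (h : IsSzegoLimit α p F) {f : ℂ → ℂ} (hf : Continuous f) :
    Tendsto (fun m => ((∏ k ∈ Finset.range m, (1 - ‖α k‖ ^ 2) : ℝ) : ℂ)
      * ∫ z, f z ∂densityMeasure (bernsteinSzegoDensity α m)) atTop
      (𝓝 (∫ z, f z ∂densityMeasure (limitDensity p F))) := by
  obtain ⟨δ, hδ, hle⟩ := exists_le_norm_snd_szegoSol h.norm_lt_one h.summable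
  have hg := continuousOn_bernsteinSzegoDensity h.norm_lt_one
  rw [integral_densityMeasure h.continuousOn_density fun ζ hζ => (h.density_pos ζ hζ).le]
  simp only [integral_densityMeasure (hg _) fun ζ _ => bernsteinSzegoDensity_nonneg α _ ζ,
    ← integral_const_mul]
  have hint : Integrable f arcMeasure :=
    integrable_of_continuousOn_sphere arcMeasure_compl_sphere hf.continuousOn
  refine tendsto_integral_of_dominated_convergence (fun ζ => (δ ^ 2)⁻¹ * ‖f ζ‖) (fun m => ?_)
    (hint.norm.const_mul _) (fun m => ?_) ?_
  · have hc : ContinuousOn (fun ζ => ((∏ k ∈ Finset.range m, (1 - ‖α k‖ ^ 2) : ℝ) : ℂ)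
        * ((bernsteinSzegoDensity α m ζ : ℂ) * f ζ)) (Metric.sphere 0 1) :=
      continuousOn_const.mul ((Complex.continuous_ofReal.comp_continuousOn (hg m)).mul
        hf.continuousOn)
    exact (integrable_of_continuousOn_sphere arcMeasure_compl_sphere hc).aestronglyMeasurable
  · filter_upwards [mem_ae_iff.2 arcMeasure_compl_sphere] with ζ hζ
    have h1 : ∀ k, 0 ≤ 1 - ‖α k‖ ^ 2 := fun k =>
      sub_nonneg.2 (pow_le_one₀ (norm_nonneg _) (h.norm_lt_one k).le)
    have h2 : ∏ k ∈ Finset.range m, (1 - ‖α k‖ ^ 2) ≤ 1 :=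
      Finset.prod_le_one (fun k _ => h1 k) fun k _ => by linarith [sq_nonneg ‖α k‖]
    have h3 : bernsteinSzegoDensity α m ζ ≤ (δ ^ 2)⁻¹ := by
      rw [bernsteinSzegoDensity, Complex.normSq_eq_norm_sq]
      have := hle ζ (mem_sphere_zero_iff_norm.1 hζ).le m
      gcongr
    rw [norm_mul, norm_mul, Complex.norm_real, Complex.norm_real,
      Real.norm_of_nonneg (Finset.prod_nonneg fun k _ => h1 k),
      Real.norm_of_nonneg (bernsteinSzegoDensity_nonneg α m ζ), ← mul_assoc]
    gcongr
    calc _ ≤ 1 * (δ ^ 2)⁻¹ := by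
          gcongr
          exact bernsteinSzegoDensity_nonneg α m ζ
      _ = _ := one_mul _
  · filter_upwards [mem_ae_iff.2 arcMeasure_compl_sphere] with ζ hζ
    have hz := (mem_sphere_zero_iff_norm.1 hζ).le
    have h1 : Tendsto (fun m => (∏ k ∈ Finset.range m, (1 - ‖α k‖ ^ 2))
        * bernsteinSzegoDensity α m ζ) atTop (𝓝 (limitDensity p F ζ)) :=
      h.tendsto_prod.mul (((Complex.continuous_normSq.tendsto _).comp
        (h.tendsto_snd ζ hz)).inv₀ ((_root_.map_ne_zero _).2 (h.ne_zero hz)))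
    have h2 := ((Complex.continuous_ofReal.tendsto _).comp h1).mul_const (f ζ)
    refine h2.congr fun m => ?_
    simp only [Function.comp_apply, Complex.ofReal_mul]
    ring

theorem isNontrivial (h : IsSzegoLimit α p F) :
    IsNontrivialCircleMeasure (densityMeasure (limitDensity p F)) := by
  have hpos : ∀ ζ ∈ Metric.sphere (0 : ℂ) 1, 0 ≤ limitDensity p F ζ :=
    fun ζ hζ => (h.density_pos ζ hζ).le
  refine isNontrivialCircleMeasure_densityMeasure h.continuousOn_density hpos ?_
  have h1 : ∫ _, (1 : ℂ) ∂densityMeasure (limitDensity p F) = 1 := by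
    refine tendsto_nhds_unique (h.tendsto_integral (f := fun _ => 1) continuous_const) ?_
    refine tendsto_const_nhds.congr fun m => ?_
    have := isFiniteMeasure_densityMeasure
      (continuousOn_bernsteinSzegoDensity h.norm_lt_one m)
    obtain ⟨h2, h3⟩ := isSzegoOrthogonal_bernsteinSzego h.norm_lt_one m
    rw [h2.prod_mul_measure (densityMeasure_compl_sphere _) h.norm_lt_one, h3]
  rw [integral_densityMeasure h.continuousOn_density hpos] at h1
  simpa using h1

/-- For every `m ≥ n` the same `Φ_n` is already orthogonal with respect to the `m`-th
Bernstein–Szegő measure, so the integrals vanish before the limit. -/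
theorem isMonicOP (h : IsSzegoLimit α p F) (n : ℕ) :
    IsMonicOP (densityMeasure (limitDensity p F)) n (szegoPoly α n).1 := by
  obtain ⟨h1, h2, -⟩ := degree_szegoPoly α n
  refine ⟨h1, h2, fun k hk => ?_⟩
  simp only [(eval_szegoPoly α _ n).1]
  have hc : Continuous fun z : ℂ => conj (z ^ k) * (szegoSol α z (1, 1) n).1 :=
    (Complex.continuous_conj.comp (by fun_prop)).mul (continuous_szegoSol_fst α _ n)
  refine tendsto_nhds_unique (h.tendsto_integral hc) (tendsto_const_nhds.congr' ?_)
  filter_upwards [eventually_ge_atTop n] with m hm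
  have := isFiniteMeasure_densityMeasure
    (continuousOn_bernsteinSzegoDensity h.norm_lt_one m)
  rw [((isSzegoOrthogonal_bernsteinSzego h.norm_lt_one m).1.of_le (densityMeasure_compl_sphere _)
    h.norm_lt_one hm).1 k hk, mul_zero]

theorem hasVerblunskyCoeffs (h : IsSzegoLimit α p F) :
    HasVerblunskyCoeffs (densityMeasure (limitDensity p F)) α :=
  ⟨fun n => (szegoPoly α n).1, h.isMonicOP, neg_conj_eval_zero_szegoPoly α⟩

/-- The Szegő function of the measure is `√p / F`. -/
theorem szegoFunction_eq (h : IsSzegoLimit α p F) {ℓ : ℂ → ℂ}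
    (hℓ : DiffContOnCl ℂ ℓ (Metric.ball 0 1)) (hℓ0 : ℓ 0 = 0)
    (hexp : ∀ z ∈ Metric.closedBall (0 : ℂ) 1, Complex.exp (ℓ z) = F z) {z : ℂ}
    (hz : z ∈ Metric.ball (0 : ℂ) 1) :
    szegoFunction (densityMeasure (limitDensity p F)) z = (√p : ℂ) / F z := by
  have hsq : (√p : ℂ) = Complex.exp ((Real.log p / 2 : ℝ) : ℂ) := by
    rw [← Complex.ofReal_exp, Real.exp_half, Real.exp_log h.p_pos]
  -- On the circle the real part of this function is `log w`, since `w = p |F|⁻²`; its value at `0`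
  -- is real because `ℓ 0 = 0`.
  have hD : DiffContOnCl ℂ (fun z => ((Real.log p : ℝ) : ℂ) - 2 * ℓ z) (Metric.ball 0 1) :=
    diffContOnCl_const.sub (hℓ.const_smul (2 : ℂ))
  have hs := integral_arcMeasure_schwarz hD (by simp [hℓ0]) hz
  have hi : ∫ ζ, (ζ + z) / (ζ - z)
      * (Real.log (weight (densityMeasure (limitDensity p F)) ζ) : ℂ) ∂arcMeasure
      = ((Real.log p : ℝ) : ℂ) - 2 * ℓ z := by
    rw [← hs]
    refine integral_congr_ae ?_
    filter_upwards [mem_ae_iff.2 arcMeasure_compl_sphere, weight_densityMeasure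
      h.continuousOn_density fun ζ hζ => (h.density_pos ζ hζ).le] with ζ hζ hw
    have hF := h.ne_zero (mem_sphere_zero_iff_norm.1 hζ).le
    have hFn : ‖F ζ‖ = Real.exp (ℓ ζ).re := by
      rw [← hexp ζ (Metric.sphere_subset_closedBall hζ), Complex.norm_exp]
    have hlog : Real.log (limitDensity p F ζ) = Real.log p - 2 * (ℓ ζ).re := by
      rw [limitDensity, Real.log_mul h.p_pos.ne' (inv_ne_zero ((_root_.map_ne_zero _).2 hF)),
        Complex.normSq_eq_norm_sq, hFn, Real.log_inv, Real.log_pow, Real.log_exp]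
      push_cast
      ring
    rw [hw, hlog]
    simp
  rw [szegoFunction, hi, hsq, ← hexp z (Metric.ball_subset_closedBall hz), ← Complex.exp_sub]
  congr 1
  push_cast
  ring

end IsSzegoLimit

/-- A zero-free analytic function on a disk has an analytic logarithm. -/
theorem exists_diffContOnCl_log {F : ℂ → ℂ} {s : ℝ} (hs : 1 < s)
    (hF : DifferentiableOn ℂ F (Metric.ball 0 s)) (hF0 : F 0 = 1)
    (hne : ∀ z : ℂ, ‖z‖ ≤ 1 → F z ≠ 0) :
    ∃ ℓ : ℂ → ℂ, DiffContOnCl ℂ ℓ (Metric.ball 0 1) ∧ ℓ 0 = 0 ∧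
      ∀ z ∈ Metric.closedBall (0 : ℂ) 1, Complex.exp (ℓ z) = F z := by
  -- By compactness `F` has no zeros on a slightly larger disk, so a primitive of `F' / F` there is
  -- regular up to the unit circle.
  obtain ⟨s', hs1, hss, hne'⟩ : ∃ s', 1 < s' ∧ s' ≤ s ∧
      ∀ z ∈ Metric.ball (0 : ℂ) s', F z ≠ 0 := by
    have hopen : IsOpen (Metric.ball (0 : ℂ) s ∩ F ⁻¹' {0}ᶜ) :=
      hF.continuousOn.isOpen_inter_preimage Metric.isOpen_ball isOpen_compl_singleton
    have hsub : Metric.closedBall (0 : ℂ) 1 ⊆ Metric.ball (0 : ℂ) s ∩ F ⁻¹' {0}ᶜ := fun z hz =>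
      ⟨Metric.closedBall_subset_ball hs hz, hne z (mem_closedBall_zero_iff.1 hz)⟩
    obtain ⟨ε, hε, hsub'⟩ :=
      (isCompact_closedBall (0 : ℂ) 1).exists_thickening_subset_open hopen hsub
    rw [thickening_closedBall hε zero_le_one] at hsub'
    refine ⟨min (ε + 1) s, lt_min (by linarith) hs, min_le_right _ _, fun z hz => ?_⟩
    exact (hsub' (Metric.ball_subset_ball (min_le_left _ _) hz)).2
  have hF' : DifferentiableOn ℂ F (Metric.ball 0 s') := hF.mono (Metric.ball_subset_ball hss)
  have hdl : DifferentiableOn ℂ (fun z => deriv F z / F z) (Metric.ball 0 s') :=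
    (hF'.deriv Metric.isOpen_ball).div hF' hne'
  obtain ⟨ℓ, hℓ⟩ := hdl.isExactOn_ball.with_val_at 0 0
  obtain ⟨hℓ0, hℓ⟩ := hℓ
  have hball : Metric.closedBall (0 : ℂ) 1 ⊆ Metric.ball 0 s' := Metric.closedBall_subset_ball hs1
  have hd : DifferentiableOn ℂ (fun z => Complex.exp (-ℓ z) * F z) (Metric.ball 0 s') := by
    refine DifferentiableOn.mul (DifferentiableOn.cexp (DifferentiableOn.neg fun z hz => ?_)) hF'
    exact (hℓ z hz).differentiableAt.differentiableWithinAt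
  have hconst : ∀ z ∈ Metric.ball (0 : ℂ) s', Complex.exp (-ℓ z) * F z = 1 := by
    intro z hz
    have h0 : (0 : ℂ) ∈ Metric.ball (0 : ℂ) s' := Metric.mem_ball_self (by linarith)
    have := (convex_ball (0 : ℂ) s').is_const_of_fderivWithin_eq_zero (𝕜 := ℂ) hd
      (fun x hx => ?_) hz h0
    · rw [this, hℓ0, hF0]; simp
    · have h1 := ((hℓ x hx).neg.cexp).mul
        (hF'.differentiableAt (Metric.isOpen_ball.mem_nhds hx)).hasDerivAt
      rw [fderivWithin_of_isOpen Metric.isOpen_ball hx]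
      have h2 : HasDerivAt (fun z => Complex.exp (-ℓ z) * F z) 0 x := by
        refine h1.congr_deriv ?_
        have := hne' x hx
        simp only [Pi.neg_apply]
        field_simp
        ring
      exact h2.hasFDerivAt.fderiv.trans (by ext; simp)
  refine ⟨ℓ, ?_, hℓ0, fun z hz => ?_⟩
  · refine DifferentiableOn.diffContOnCl ?_
    rw [closure_ball (0 : ℂ) one_ne_zero]
    exact fun z hz => (hℓ z (hball hz)).differentiableAt.differentiableWithinAt
  · have := hconst z (hball hz)
    rw [Complex.exp_neg, inv_mul_eq_one₀ (Complex.exp_ne_zero _)] at this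
    exact this

/-! ### Uniqueness -/

/-- In the inductive step the difference `Q` of the two polynomials has degree at most `n`, vanishes
at `0`, and is orthogonal to `z, …, z ^ n`, hence to itself. A nonzero `Q` would confine `ν` to its
finitely many roots. -/
theorem HasVerblunskyCoeffs.eq_szegoPoly {ν : Measure ℂ} (hν : IsNontrivialCircleMeasure ν)
    {α : ℕ → ℂ} {Φ : ℕ → ℂ[X]} (hΦ : ∀ n, IsMonicOP ν n (Φ n))
    (hα : ∀ n, α n = -conj ((Φ (n + 1)).eval 0)) (n : ℕ) : Φ n = (szegoPoly α n).1 := by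
  have := hν.isProbabilityMeasure
  induction n with
  | zero =>
    obtain ⟨h1, h2, -⟩ := hΦ 0
    simpa [szegoPoly] using h1.natDegree_eq_zero.1 h2
  | succ n ih =>
    obtain ⟨m1, d1, o1⟩ := hΦ (n + 1)
    obtain ⟨m2, d2, -⟩ := degree_szegoPoly α (n + 1)
    have hint : ∀ f : ℂ → ℂ, Continuous f → Integrable f ν :=
      fun f hf => integrable_of_continuousOn_sphere hν.compl_circle hf.continuousOn
    have horth : IsSzegoOrthogonal ν α n := by
      refine isSzegoOrthogonal_of_fst hν.compl_circle fun k hk => ?_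
      simp only [← (eval_szegoPoly α _ n).1, ← ih]
      exact (hΦ n).2.2 k hk
    set Q := Φ (n + 1) - (szegoPoly α (n + 1)).1 with hQ
    have hQdeg : Q.natDegree < n + 1 := by
      rcases eq_or_ne Q 0 with h0 | h0
      · rw [h0]; simp
      · rw [natDegree_lt_iff_degree_lt h0]
        have := degree_sub_lt_left (p := Φ (n + 1)) (q := (szegoPoly α (n + 1)).1)
          (by rw [degree_eq_natDegree m1.ne_zero, degree_eq_natDegree m2.ne_zero, d1, d2])
          m1.ne_zero (by rw [m1.leadingCoeff, m2.leadingCoeff])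
        rwa [degree_eq_natDegree m1.ne_zero, d1] at this
    have hQ0 : Q.coeff 0 = 0 := by
      have h3 : (Φ (n + 1)).eval 0 = ((szegoPoly α (n + 1)).1).eval 0 :=
        star_injective (neg_injective ((hα n).symm.trans (neg_conj_eval_zero_szegoPoly α n)))
      rw [coeff_zero_eq_eval_zero, hQ, eval_sub, h3, sub_self]
    have hQorth : ∀ k, 1 ≤ k → k ≤ n → ∫ z, conj (z ^ k) * Q.eval z ∂ν = 0 := by
      intro k hk1 hkn
      have e : ∀ᵐ z ∂ν, conj (z ^ k) * Q.eval z = conj (z ^ k) * (Φ (n + 1)).eval z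
          - (conj (z ^ (k - 1)) * (szegoSol α z (1, 1) n).1
            - conj (α n) * (conj (z ^ k) * (szegoSol α z (1, 1) n).2)) := by
        filter_upwards [mem_ae_iff.2 hν.compl_circle] with z hz
        have h0 := ne_zero_of_mem_sphere hz
        rw [hQ, eval_sub, (eval_szegoPoly α z (n + 1)).1, szegoSol_succ_fst]
        obtain ⟨j, rfl⟩ := Nat.exists_eq_add_of_le' hk1
        have h1 : conj (z ^ (j + 1)) * z = conj (z ^ j) := by
          rw [map_pow, map_pow, pow_succ, mul_assoc, conj_eq_inv_of_mem_sphere hz,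
            inv_mul_cancel₀ h0, mul_one]
        rw [Nat.add_sub_cancel, ← h1]
        ring
      have i1 : ∀ k, Integrable (fun z => conj (z ^ k) * (Φ (n + 1)).eval z) ν := fun k =>
        hint _ ((Complex.continuous_conj.comp (by fun_prop)).mul (by fun_prop))
      have i2 : ∀ k, Integrable (fun z => conj (z ^ k) * (szegoSol α z (1, 1) n).1) ν := fun k =>
        hint _ ((Complex.continuous_conj.comp (by fun_prop)).mul (continuous_szegoSol_fst α _ n))
      have i3 : ∀ k, Integrable (fun z => conj (z ^ k) * (szegoSol α z (1, 1) n).2) ν := fun k =>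
        hint _ ((Complex.continuous_conj.comp (by fun_prop)).mul (continuous_szegoSol_snd α _ n))
      have i3' := (i3 k).const_mul (conj (α n))
      have i4 : Integrable (fun z => conj (z ^ (k - 1)) * (szegoSol α z (1, 1) n).1
          - conj (α n) * (conj (z ^ k) * (szegoSol α z (1, 1) n).2)) ν := (i2 _).sub i3'
      rw [integral_congr_ae e, integral_sub (i1 k) i4, integral_sub (i2 _) i3',
        integral_const_mul, o1 k (by omega),
        horth.1 (k - 1) (by omega), horth.2 k hk1 hkn]
      simp
    have hnorm : ∫ z, conj (Q.eval z) * Q.eval z ∂ν = 0 := by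
      have e : ∀ z, conj (Q.eval z) * Q.eval z
          = ∑ k ∈ Finset.range (n + 1), conj (Q.coeff k) * (conj (z ^ k) * Q.eval z) := by
        intro z
        conv_lhs => rw [eval_eq_sum_range' hQdeg z, map_sum, ← eval_eq_sum_range' hQdeg z,
          Finset.sum_mul]
        refine Finset.sum_congr rfl fun k _ => ?_
        rw [map_mul]; ring
      simp only [e]
      have hi : ∀ k, Integrable (fun z => conj (Q.coeff k) * (conj (z ^ k) * Q.eval z)) ν :=
        fun k => (hint (fun z => conj (z ^ k) * Q.eval z) ((Complex.continuous_conj.comp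
          (by fun_prop)).mul (by fun_prop))).const_mul _
      rw [integral_finsetSum _ fun k _ => hi k]
      refine Finset.sum_eq_zero fun k hk => ?_
      rw [integral_const_mul]
      rcases Nat.eq_zero_or_pos k with rfl | hk0
      · rw [hQ0]; simp
      · rw [hQorth k hk0 (by simpa using Nat.lt_succ_iff.1 (Finset.mem_range.1 hk)), mul_zero]
    have hnorm' : ∫ z, Complex.normSq (Q.eval z) ∂ν = 0 := by
      have e : ∀ z, conj (Q.eval z) * Q.eval z = ((Complex.normSq (Q.eval z) : ℝ) : ℂ) :=
        fun z => by rw [mul_comm, Complex.mul_conj]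
      simp only [e] at hnorm
      rw [integral_complex_ofReal] at hnorm
      exact_mod_cast hnorm
    rw [integral_eq_zero_iff_of_nonneg (fun z => Complex.normSq_nonneg _)
      (integrable_of_continuousOn_sphere hν.compl_circle
        (Complex.continuous_normSq.comp (by fun_prop)).continuousOn)] at hnorm'
    by_contra hne
    have hQne : Q ≠ 0 := sub_ne_zero.2 hne
    refine hν.not_finite {z | Q.IsRoot z} (finite_setOfPred_isRoot hQne) ?_
    rw [← mem_ae_iff]
    filter_upwards [hnorm'] with z hz
    exact Complex.normSq_eq_zero.1 hz

/-- A nontrivial measure on the circle is determined by its Verblunsky coefficients. -/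
theorem HasVerblunskyCoeffs.unique {μ ν : Measure ℂ} (hμ : IsNontrivialCircleMeasure μ)
    (hν : IsNontrivialCircleMeasure ν) {α : ℕ → ℂ} (h : HasVerblunskyCoeffs μ α)
    (h' : HasVerblunskyCoeffs ν α) : μ = ν := by
  have := hμ.isProbabilityMeasure
  have := hν.isProbabilityMeasure
  -- Orthogonality of the monic `Φ_{n+1}` to `1` expresses the moment of order `n + 1` through the
  -- lower ones, with coefficients depending on `α` alone.
  have key : ∀ {ρ : Measure ℂ}, IsNontrivialCircleMeasure ρ → HasVerblunskyCoeffs ρ α →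
      ∀ n, ∫ z, z ^ (n + 1) ∂ρ
        = ∑ k ∈ Finset.range (n + 1), -((szegoPoly α (n + 1)).1.coeff k * ∫ z, z ^ k ∂ρ) := by
    intro ρ hρ hc n
    have := hρ.isProbabilityMeasure
    obtain ⟨Φ, hΦ, hα⟩ := hc
    have e := HasVerblunskyCoeffs.eq_szegoPoly hρ hΦ hα (n + 1)
    have h0 := (hΦ (n + 1)).2.2 0 (by omega)
    obtain ⟨m1, d1, -⟩ := degree_szegoPoly α (n + 1)
    have hint : ∀ (c : ℂ) (k : ℕ), Integrable (fun z : ℂ => c * z ^ k) ρ := fun c k =>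
      integrable_of_continuousOn_sphere hρ.compl_circle (by fun_prop)
    have hlead : (szegoPoly α (n + 1)).1.coeff (n + 1) = 1 := by
      have := m1.coeff_natDegree
      rwa [d1] at this
    simp only [e, pow_zero, map_one, one_mul, eval_eq_sum_range, d1] at h0
    rw [integral_finsetSum _ fun k _ => hint _ k, Finset.sum_range_succ, hlead] at h0
    simp only [one_mul, integral_const_mul] at h0
    rw [Finset.sum_neg_distrib]
    exact eq_neg_of_add_eq_zero_right h0
  refine eq_of_moments_eq hμ.compl_circle hν.compl_circle fun n => ?_
  induction n using Nat.strong_induction_on with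
  | _ n ih =>
    cases n with
    | zero => simp
    | succ n =>
      rw [key hμ h, key hν h']
      refine Finset.sum_congr rfl fun k hk => ?_
      rw [ih k (Finset.mem_range.1 hk)]

/-! ### Singular points in terms of `szegoCont` -/

theorem one_sub_mul_eq_zero_iff {b : ℝ} (hb : 0 < b) {z : ℂ} :
    1 - b * z = 0 ↔ z = (b : ℂ)⁻¹ := by
  have hbc : (b : ℂ) ≠ 0 := by exact_mod_cast hb.ne'
  rw [sub_eq_zero]
  constructor
  · exact fun h => eq_inv_of_mul_eq_one_right h.symm
  · rintro rfl
    exact (mul_inv_cancel₀ hbc).symm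

theorem norm_ofReal_inv {b : ℝ} (hb : 0 < b) : ‖(b : ℂ)⁻¹‖ = b⁻¹ := by
  rw [norm_inv, Complex.norm_real, Real.norm_of_nonneg hb.le]

/-- The identity theorem for meromorphic functions on a connected disk gives equality near `z` off
`z` itself; continuity at `z` gives it at the point. At `b⁻¹` the values are arbitrary. -/
theorem IsSzegoInverseContinuation.eq_of_ne {b : ℝ} (hb : 0 < b) {μ : Measure ℂ}
    {G G' : ℂ → ℂ} (h : IsSzegoInverseContinuation b μ G)
    (h' : IsSzegoInverseContinuation b μ G') {z : ℂ} (hz : ‖z‖ = b⁻¹) (hne : z ≠ (b : ℂ)⁻¹) :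
    G z = G' z := by
  obtain ⟨R, hR, hm, ha, he⟩ := h
  obtain ⟨R', hR', hm', ha', he'⟩ := h'
  have hb' : 0 < b⁻¹ := inv_pos.2 hb
  have hS : Metric.ball (0 : ℂ) (min R R') ⊆ Metric.ball 0 R :=
    Metric.ball_subset_ball (min_le_left _ _)
  have hS' : Metric.ball (0 : ℂ) (min R R') ⊆ Metric.ball 0 R' :=
    Metric.ball_subset_ball (min_le_right _ _)
  have hzS : z ∈ Metric.ball (0 : ℂ) (min R R') := by
    rw [mem_ball_zero_iff, hz]; exact lt_min hR hR'
  have h0S : (0 : ℂ) ∈ Metric.ball (0 : ℂ) (min R R') :=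
    Metric.mem_ball_self (hb'.trans (lt_min hR hR'))
  have hmer : MeromorphicOn (G - G') (Metric.ball 0 (min R R')) :=
    fun x hx => (hm x (hS hx)).sub (hm' x (hS' hx))
  have h0 : meromorphicOrderAt (G - G') 0 = ⊤ := by
    rw [meromorphicOrderAt_eq_top_iff]
    refine Filter.Eventually.filter_mono nhdsWithin_le_nhds ?_
    filter_upwards [Metric.ball_mem_nhds (0 : ℂ) one_pos] with x hx
    rw [Pi.sub_apply, he x hx, he' x hx, sub_self]
  have hztop : meromorphicOrderAt (G - G') z = ⊤ := by
    by_contra hcon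
    exact hmer.meromorphicOrderAt_ne_top_of_isPreconnected Metric.isPreconnected_ball hzS h0S
      hcon h0
  rw [meromorphicOrderAt_eq_top_iff] at hztop
  have hc : ContinuousAt (G - G') z :=
    ((ha z ⟨hS hzS, hne⟩).sub (ha' z ⟨hS' hzS, hne⟩)).continuousAt
  have hlim : Tendsto (G - G') (𝓝[≠] z) (𝓝 0) :=
    tendsto_const_nhds.congr' (hztop.mono fun _ hx => hx.symm)
  exact sub_eq_zero.1 (tendsto_nhds_unique (hc.tendsto.mono_left nhdsWithin_le_nhds) hlim)

/-- The reflection `z ↦ 1 / conj z` exchanges `|z| = b` and `|z| = b⁻¹` and sends `b` to `b⁻¹`. The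
value of `G` at `b⁻¹` is irrelevant, as `b` always counts as singular. -/
theorem singularPoints_eq_singleton_iff {b : ℝ} (hb : 0 < b) (G : ℂ → ℂ) :
    singularPoints b G = {(b : ℂ)} ↔ ∀ z : ℂ, ‖z‖ = b⁻¹ → z ≠ (b : ℂ)⁻¹ → G z ≠ 0 := by
  have hnb : ‖(b : ℂ)‖ = b := by rw [Complex.norm_real, Real.norm_of_nonneg hb.le]
  constructor
  · intro h z hz hne h0
    have hmem : (conj z)⁻¹ ∈ singularPoints b G := by
      refine ⟨by rw [norm_inv, RCLike.norm_conj, hz, inv_inv], Or.inr ?_⟩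
      rw [map_inv₀, Complex.conj_conj, one_div, inv_inv, h0]
    rw [h, mem_singleton_iff] at hmem
    apply hne
    rw [← hmem, inv_inv, ← Complex.conj_conj z, ← inv_inv (conj z), hmem, map_inv₀,
      Complex.conj_ofReal, map_inv₀, Complex.conj_ofReal]
  · intro h
    ext w
    rw [mem_singleton_iff]
    constructor
    · rintro ⟨hw, rfl | h0⟩
      · rfl
      by_contra hne
      refine h (1 / conj w) ?_ ?_ h0
      · rw [one_div, norm_inv, RCLike.norm_conj, hw]
      · rw [one_div]
        intro h1
        apply hne
        rw [← Complex.conj_conj w, inv_injective h1, Complex.conj_ofReal]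
    · rintro rfl
      exact ⟨hnb, Or.inl rfl⟩

namespace Rates

theorem exists_isSzegoLimit (h : Rates b t r) {α : ℕ → ℂ} (hα : α ∈ decaySet b t M)
    (h1 : ∀ j, ‖α j‖ < 1) (hr : b⁻¹ < r) :
    ∃ p, IsSzegoLimit α p fun z => szegoCont b α z (1, 1) / (1 - b * z) := by
  have hb := h.b_pos
  have hs := summable_norm_of_mem_decaySet hb h.b_lt_one hα
  have h1r : 1 < r := (one_lt_inv₀ hb).2 h.b_lt_one |>.trans hr
  obtain ⟨p, hp, hlim, -⟩ := exists_pos_tendsto_prod_one_sub (a := fun j => ‖α j‖ ^ 2)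
    (fun j => by positivity) (fun j => pow_lt_one₀ (norm_nonneg _) (h1 j) two_ne_zero)
    (Summable.of_nonneg_of_le (fun j => by positivity)
      (fun j => pow_le_of_le_one (norm_nonneg _) (h1 j).le two_ne_zero) hs)
  refine ⟨p, h1, hs, hp, hlim, fun z hz => ?_, ?_⟩
  · exact h.tendsto_snd_szegoSol hα (hz.trans h1r.le)
      ((mul_le_of_le_one_left hb.le hz).trans_lt h.b_lt_one) _
  · refine ContinuousOn.div ((h.differentiableOn_szegoCont hα _).continuousOn.mono
      (Metric.closedBall_subset_ball h1r)) (by fun_prop) fun z hz h0 => ?_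
    rw [one_sub_mul_eq_zero_iff hb] at h0
    rw [mem_closedBall_zero_iff, h0, norm_ofReal_inv hb] at hz
    exact absurd ((one_lt_inv₀ hb).2 h.b_lt_one) (not_lt.2 hz)

/-- The measure with Verblunsky coefficients `α`, together with the continuation of the inverse
of its Szegő function. -/
theorem exists_measure (h : Rates b t r) {α : ℕ → ℂ} (hα : α ∈ decaySet b t M)
    (h1 : ∀ j, ‖α j‖ < 1) (hr : b⁻¹ < r) :
    ∃ (μ : Measure ℂ) (κ : ℂ), κ ≠ 0 ∧ IsNontrivialCircleMeasure μ ∧ HasVerblunskyCoeffs μ α ∧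
      SzegoCondition μ ∧ IsSzegoInverseContinuation b μ
        fun z => κ * (szegoCont b α z (1, 1) / (1 - b * z)) := by
  have hb := h.b_pos
  obtain ⟨p, hp⟩ := h.exists_isSzegoLimit hα h1 hr
  set F : ℂ → ℂ := fun z => szegoCont b α z (1, 1) / (1 - b * z) with hF
  have hb1 : 1 < b⁻¹ := (one_lt_inv₀ hb).2 h.b_lt_one
  have hK := h.differentiableOn_szegoCont hα (1, 1)
  have hFd : DifferentiableOn ℂ F (Metric.ball 0 b⁻¹) := by
    refine DifferentiableOn.div (hK.mono (Metric.ball_subset_ball hr.le)) (by fun_prop)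
      fun z hz h0 => ?_
    rw [one_sub_mul_eq_zero_iff hb] at h0
    rw [mem_ball_zero_iff, h0, norm_ofReal_inv hb] at hz
    exact lt_irrefl _ hz
  obtain ⟨ℓ, hℓ, hℓ0, hexp⟩ := exists_diffContOnCl_log hb1 hFd hp.apply_zero
    fun z hz => hp.ne_zero hz
  have hκ : ((√p : ℝ) : ℂ)⁻¹ ≠ 0 :=
    inv_ne_zero (by exact_mod_cast (Real.sqrt_pos.2 hp.p_pos).ne')
  have hKa : AnalyticOnNhd ℂ (fun z => szegoCont b α z (1, 1)) (Metric.ball 0 r) :=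
    hK.analyticOnNhd Metric.isOpen_ball
  have hlin : ∀ x : ℂ, AnalyticAt ℂ (fun z : ℂ => 1 - b * z) x := fun x => by fun_prop
  refine ⟨densityMeasure (limitDensity p F), ((√p : ℝ) : ℂ)⁻¹, hκ, hp.isNontrivial,
    hp.hasVerblunskyCoeffs, szegoCondition_densityMeasure hp.continuousOn_density hp.density_pos,
    r, hr, fun x hx => ?_, fun x hx => ?_, fun x hx => ?_⟩
  · exact (MeromorphicAt.const _ x).mul ((hKa x hx).meromorphicAt.div (hlin x).meromorphicAt)
  · exact analyticAt_const.mul ((hKa x hx.1).div (hlin x)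
      fun h0 => hx.2 ((one_sub_mul_eq_zero_iff hb).1 h0))
  · rw [hp.szegoFunction_eq hℓ hℓ0 hexp hx, inv_div, div_eq_mul_inv, mul_comm]

/-- The forward direction starts from an arbitrary measure and continuation, so it needs uniqueness
of both. -/
theorem onlySingularPoint_iff (h : Rates b t r) {α : ℕ → ℂ} (hα : α ∈ decaySet b t M)
    (h1 : ∀ j, ‖α j‖ < 1) (hr : b⁻¹ < r) :
    OnlySingularPoint b α ↔
      ∀ z : ℂ, ‖z‖ = b⁻¹ → z ≠ (b : ℂ)⁻¹ → szegoCont b α z (1, 1) ≠ 0 := by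
  have hb := h.b_pos
  obtain ⟨μ, κ, hκ, hμ, hv, hs, hG⟩ := h.exists_measure hα h1 hr
  have hiff : ∀ z : ℂ, z ≠ (b : ℂ)⁻¹ →
      (κ * (szegoCont b α z (1, 1) / (1 - b * z)) ≠ 0 ↔ szegoCont b α z (1, 1) ≠ 0) := by
    intro z hz
    have := mt (one_sub_mul_eq_zero_iff hb).1 hz
    simp [hκ, this]
  constructor
  · rintro ⟨ν, G, hν, hv', -, hG', hsing⟩ z hz hne
    obtain rfl := HasVerblunskyCoeffs.unique hμ hν hv hv'
    rw [← hiff z hne, ← hG'.eq_of_ne hb hG hz hne]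
    exact (singularPoints_eq_singleton_iff hb G).1 hsing z hz hne
  · intro hne
    refine ⟨μ, _, hμ, hv, hs, hG, (singularPoints_eq_singleton_iff hb _).2 fun z hz hz' => ?_⟩
    exact (hiff z hz').2 (hne z hz hz')

end Rates

/-! ### Sequences in `V b Δ` -/

variable {Δ : ℝ}

theorem exists_rates (hb : b ∈ Ioo (0 : ℝ) 1) (hΔ : Δ ∈ Ioo (0 : ℝ) 1) :
    ∃ r, b⁻¹ < r ∧ Rates b (Δ * b) r := by
  have hb0 := hb.1
  have hs : max b Δ < 1 := max_lt hb.2 hΔ.2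
  have hs0 : 0 < max b Δ := lt_max_of_lt_left hb0
  -- With `r = q / b` and `t = Δ b`, the two rate conditions become `q Δ < 1` and `q b < 1`.
  obtain ⟨q, hq1, hq⟩ := exists_between ((one_lt_inv₀ hs0).2 hs)
  have hqs : q * max b Δ < 1 := (lt_div_iff₀ hs0).1 (by rwa [one_div])
  have hq0 : 0 < q := by linarith
  have h1 : 1 < b⁻¹ := (one_lt_inv₀ hb0).2 hb.2
  have hbr : b⁻¹ < b⁻¹ * q := lt_mul_of_one_lt_right (inv_pos.2 hb0) hq1
  refine ⟨b⁻¹ * q, hbr, hb0, hb.2, mul_nonneg hΔ.1.le hb0.le, (h1.trans hbr).le, ?_, ?_⟩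
  · calc b⁻¹ * q * (Δ * b) = q * Δ := by field_simp
      _ ≤ q * max b Δ := by gcongr; exact le_max_right _ _
      _ < 1 := hqs
  · calc b⁻¹ * q * b ^ 2 = q * b := by field_simp
      _ ≤ q * max b Δ := by gcongr; exact le_max_left _ _
      _ < 1 := hqs

theorem eq_add_remainder (hb : 0 < b) (hΔ : 0 < Δ) (C : ℂ) (γ : ℕ → ℂ) (j : ℕ) :
    γ j = C * (b : ℂ) ^ j + remainder b Δ C γ j * ((Δ * b : ℝ) : ℂ) ^ j := by
  have hb' : (b : ℂ) ≠ 0 := by exact_mod_cast hb.ne'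
  have hΔ' : (Δ : ℂ) ≠ 0 := by exact_mod_cast hΔ.ne'
  rw [remainder, Complex.ofReal_mul, mul_pow]
  field_simp
  ring

theorem mem_decaySet_of_remainder_le (hb : b ∈ Ioo (0 : ℝ) 1) (hΔ : Δ ∈ Ioo (0 : ℝ) 1) {A : ℝ}
    {C : ℂ} {γ : ℕ → ℂ} (hC : ‖C‖ ≤ A) (hrem : ∀ j, ‖remainder b Δ C γ j‖ ≤ A) :
    γ ∈ decaySet b (Δ * b) (2 * A) := by
  have hb0 := hb.1
  have hΔ0 := hΔ.1
  have hA : 0 ≤ A := (norm_nonneg _).trans hC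
  have ht0 : 0 ≤ Δ * b := by positivity
  have htb : Δ * b ≤ b := mul_le_of_le_one_left hb0.le hΔ.2.le
  have ht1 : Δ * b ≤ 1 := htb.trans hb.2.le
  have hpow : ∀ (s : ℝ) (_ : 0 ≤ s) (j : ℕ), ‖(s : ℂ) ^ j‖ = s ^ j := fun s hs j => by
    rw [norm_pow, Complex.norm_real, Real.norm_of_nonneg hs]
  intro n
  constructor
  · rw [eq_add_remainder hb0 hΔ0 C γ n]
    calc _ ≤ ‖C‖ * b ^ n + ‖remainder b Δ C γ n‖ * (Δ * b) ^ n := by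
          refine (norm_add_le _ _).trans_eq ?_
          rw [norm_mul, norm_mul, hpow b hb0.le, hpow _ ht0]
      _ ≤ A * b ^ n + A * b ^ n := by
          gcongr
          exact hrem n
      _ = 2 * A * b ^ n := by ring
  -- The leading terms `C b ^ (n + 1)` cancel, leaving the faster rate `(Δ b) ^ n`.
  · have e : γ (n + 1) - b * γ n = remainder b Δ C γ (n + 1) * ((Δ * b : ℝ) : ℂ) ^ (n + 1)
        - b * (remainder b Δ C γ n * ((Δ * b : ℝ) : ℂ) ^ n) := by
      linear_combination eq_add_remainder hb0 hΔ0 C γ (n + 1)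
        - b * eq_add_remainder hb0 hΔ0 C γ n
    rw [e]
    calc _ ≤ ‖remainder b Δ C γ (n + 1)‖ * (Δ * b) ^ (n + 1)
          + b * (‖remainder b Δ C γ n‖ * (Δ * b) ^ n) := by
          refine (norm_sub_le _ _).trans_eq ?_
          rw [norm_mul, norm_mul, norm_mul, hpow _ ht0, hpow _ ht0, Complex.norm_real,
            Real.norm_of_nonneg hb0.le]
      _ ≤ A * (Δ * b) ^ n + 1 * (A * (Δ * b) ^ n) := by
          have h1 := pow_le_pow_of_le_one ht0 ht1 n.le_succ
          gcongr
          · exact hrem _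
          · exact hb.2.le
          · exact hrem n
      _ = 2 * A * (Δ * b) ^ n := by ring

theorem eventually_le_norm_of_remainder_le (hb : b ∈ Ioo (0 : ℝ) 1) (hΔ : Δ ∈ Ioo (0 : ℝ) 1)
    {A : ℝ} {C : ℂ} {γ : ℕ → ℂ} (hC : C ≠ 0) (hrem : ∀ j, ‖remainder b Δ C γ j‖ ≤ A) :
    ∀ᶠ n in atTop, ‖C‖ / 2 * b ^ n ≤ ‖γ n‖ := by
  have hb0 := hb.1
  have hΔ0 := hΔ.1
  have hlim : Tendsto (fun n : ℕ => A * Δ ^ n) atTop (𝓝 0) := by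
    simpa using (tendsto_pow_atTop_nhds_zero_of_lt_one hΔ0.le hΔ.2).const_mul A
  have hCpos : 0 < ‖C‖ / 2 := by have := norm_pos_iff.2 hC; positivity
  filter_upwards [hlim.eventually_le_const hCpos] with n hn
  have h1 : ‖remainder b Δ C γ n * ((Δ * b : ℝ) : ℂ) ^ n‖ ≤ ‖C‖ / 2 * b ^ n := by
    rw [norm_mul, norm_pow, Complex.norm_real, Real.norm_of_nonneg (by positivity), mul_pow,
      ← mul_assoc]
    have h2 := hrem n
    have : ‖remainder b Δ C γ n‖ * Δ ^ n ≤ ‖C‖ / 2 := le_trans (by gcongr) hn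
    gcongr
  have h3 : ‖C * (b : ℂ) ^ n‖ = ‖C‖ * b ^ n := by
    rw [norm_mul, norm_pow, Complex.norm_real, Real.norm_of_nonneg hb0.le]
  have h4 := norm_sub_le_norm_add (C * (b : ℂ) ^ n)
    (remainder b Δ C γ n * ((Δ * b : ℝ) : ℂ) ^ n)
  rw [← eq_add_remainder hb0 hΔ0 C γ n, h3] at h4
  linarith

theorem V.norm_lt_one (α : V b Δ) (j : ℕ) : ‖α.1 j‖ < 1 := α.2.1 j

theorem V.norm_remainder_le (α : V b Δ) (j : ℕ) :
    ‖remainder b Δ α.C α.1 j‖ ≤ vNorm b Δ α.C α.1 :=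
  (Summable.le_tsum α.isLeading j fun _ _ => norm_nonneg _).trans
    (le_add_of_nonneg_left (norm_nonneg _))

theorem V.norm_C_le (α : V b Δ) : ‖α.C‖ ≤ vNorm b Δ α.C α.1 :=
  le_add_of_nonneg_right (tsum_nonneg fun _ => norm_nonneg _)

theorem V.dist_eq (α β : V b Δ) : dist α β = vNorm b Δ (α.C - β.C) (α.1 - β.1) := rfl

theorem V.norm_C_sub_le_dist (α β : V b Δ) : ‖α.C - β.C‖ ≤ dist α β :=
  le_add_of_nonneg_right (tsum_nonneg fun _ => norm_nonneg _)

theorem V.norm_remainder_sub_le_dist (α β : V b Δ) (j : ℕ) :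
    ‖remainder b Δ (α.C - β.C) (α.1 - β.1) j‖ ≤ dist α β :=
  (Summable.le_tsum (α.isLeading.sub β.isLeading) j fun _ _ => norm_nonneg _).trans
    (le_add_of_nonneg_left (norm_nonneg _))

theorem V.mem_decaySet (hb : b ∈ Ioo (0 : ℝ) 1) (hΔ : Δ ∈ Ioo (0 : ℝ) 1) (α : V b Δ) :
    α.1 ∈ decaySet b (Δ * b) (2 * vNorm b Δ α.C α.1) :=
  mem_decaySet_of_remainder_le hb hΔ α.norm_C_le α.norm_remainder_le

/-- Sequences at distance at most one from `α` decay uniformly. -/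
theorem V.mem_decaySet_of_dist_le (hb : b ∈ Ioo (0 : ℝ) 1) (hΔ : Δ ∈ Ioo (0 : ℝ) 1) (α : V b Δ)
    {β : V b Δ} (h : dist β α ≤ 1) :
    β.1 ∈ decaySet b (Δ * b) (2 * (vNorm b Δ α.C α.1 + 1)) := by
  refine mem_decaySet_of_remainder_le (C := β.C) hb hΔ ?_ fun j => ?_
  · have h1 := norm_add_le α.C (β.C - α.C)
    rw [add_sub_cancel] at h1
    exact h1.trans (add_le_add α.norm_C_le ((V.norm_C_sub_le_dist β α).trans h))
  · have h1 := norm_add_le (remainder b Δ α.C α.1 j) (remainder b Δ (β.C - α.C) (β.1 - α.1) j)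
    rw [remainder_sub, add_sub_cancel, ← remainder_sub] at h1
    exact h1.trans (add_le_add (α.norm_remainder_le j)
      ((V.norm_remainder_sub_le_dist β α j).trans h))

theorem V.continuous_val (hb : b ∈ Ioo (0 : ℝ) 1) (hΔ : Δ ∈ Ioo (0 : ℝ) 1) :
    Continuous fun α : V b Δ => α.1 := by
  refine continuous_pi fun j => ?_
  suffices LipschitzWith 2 fun α : V b Δ => α.1 j from this.continuous
  refine LipschitzWith.of_dist_le_mul fun α β => ?_
  have h := (mem_decaySet_of_remainder_le hb hΔ (V.norm_C_sub_le_dist α β)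
    (V.norm_remainder_sub_le_dist α β) j).1
  rw [dist_eq_norm]
  refine h.trans ?_
  exact mul_le_of_le_one_right (by positivity) (pow_le_one₀ hb.1.le hb.2.le)

/-! ### Curves of real-affine equations -/

/-- A `C¹` curve is locally Lipschitz, so its image has Hausdorff dimension at most `1`, below the
real dimension `2` of the plane. -/
theorem dense_compl_image_of_contDiffOn {f : ℝ → ℂ} {s : Set ℝ} (hs : IsOpen s)
    (hf : ContDiffOn ℝ 1 f s) : Dense (f '' s)ᶜ := by
  refine dense_compl_of_dimH_lt_finrank ?_
  have h1 : dimH (f '' s) ≤ dimH s := by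
    refine dimH_image_le_of_locally_lipschitzOn fun x hx => ?_
    obtain ⟨K, t, ht, hK⟩ :=
      (hf.contDiffAt (hs.mem_nhds hx)).exists_lipschitzOnWith
    exact ⟨K, t, mem_nhdsWithin_of_mem_nhds ht, hK⟩
  refine (h1.trans (dimH_mono (subset_univ s))).trans_lt ?_
  rw [Real.dimH_univ, Complex.finrank_real_complex]
  norm_num

/-- The solutions `a` of a one-parameter family of invertible real-affine equations
`p = conj a * q + a * s` form a set with dense complement. -/
theorem dense_compl_solutions {p q s : ℝ → ℂ} (hp : ContDiff ℝ 1 p) (hq : ContDiff ℝ 1 q)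
    (hs : ContDiff ℝ 1 s) :
    Dense {a : ℂ | ∃ θ, ‖q θ‖ < ‖s θ‖ ∧ p θ = conj a * q θ + a * s θ}ᶜ := by
  have hconj : ∀ {f : ℝ → ℂ}, ContDiff ℝ 1 f → ContDiff ℝ 1 fun θ => conj (f θ) :=
    fun hf => Complex.conjCLE.contDiff.comp hf
  have hne : ∀ θ, ‖q θ‖ < ‖s θ‖ → s θ * conj (s θ) - q θ * conj (q θ) ≠ 0 := by
    intro θ hθ h0
    rw [sub_eq_zero, Complex.mul_conj, Complex.mul_conj] at h0
    have h1 : Complex.normSq (s θ) = Complex.normSq (q θ) := by exact_mod_cast h0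
    rw [Complex.normSq_eq_norm_sq, Complex.normSq_eq_norm_sq] at h1
    have : ‖q θ‖ ^ 2 < ‖s θ‖ ^ 2 := by gcongr
    linarith
  set U : Set ℝ := {θ | ‖q θ‖ < ‖s θ‖} with hU
  have hUo : IsOpen U := isOpen_lt hq.continuous.norm hs.continuous.norm
  -- Cramer's rule for the equation and its conjugate, with determinant `|s|² - |q|²`, gives `a` as
  -- a `C¹` function of `θ`.
  have hd : ContDiffOn ℝ 1 (fun θ => (conj (s θ) * p θ - q θ * conj (p θ))
      / (s θ * conj (s θ) - q θ * conj (q θ))) U := by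
    simp only [div_eq_mul_inv]
    refine ContDiffOn.mul ?_ (ContDiffOn.inv ?_ fun θ hθ => hne θ hθ)
    · exact (((hconj hs).mul hp).sub (hq.mul (hconj hp))).contDiffOn
    · exact ((hs.mul (hconj hs)).sub (hq.mul (hconj hq))).contDiffOn
  refine (dense_compl_image_of_contDiffOn hUo hd).mono (compl_subset_compl.2 ?_)
  rintro a ⟨θ, hθ, he⟩
  refine ⟨θ, hθ, ?_⟩
  change _ / _ = a
  rw [div_eq_iff (hne θ hθ), he]
  simp only [map_add, map_mul, Complex.conj_conj]
  ring

/-! ### Changing one coefficient -/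

theorem IsLeading.update {γ : ℕ → ℂ} {C : ℂ} (h : IsLeading b Δ γ C) (N : ℕ) (a : ℂ) :
    IsLeading b Δ (Function.update γ N a) C := by
  refine Summable.congr_cofinite h ?_
  filter_upwards [eventually_cofinite_ne N] with j hj
  rw [remainder, remainder, Function.update_of_ne hj]

/-- Replace the coefficient with index `N` by `a`. -/
def V.update (α : V b Δ) (N : ℕ) (a : ℂ) (ha : ‖a‖ < 1) : V b Δ :=
  ⟨Function.update α.1 N a, fun j => by
    rcases eq_or_ne j N with rfl | hj
    · rwa [Function.update_self]
    · rw [Function.update_of_ne hj]; exact α.2.1 j,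
    α.C, α.C_ne_zero, α.isLeading.update N a⟩

theorem V.update_val (α : V b Δ) (N : ℕ) (a : ℂ) (ha : ‖a‖ < 1) :
    (α.update N a ha).1 = Function.update α.1 N a := rfl

theorem V.dist_update (hb : b ∈ Ioo (0 : ℝ) 1) (hΔ : Δ ∈ Ioo (0 : ℝ) 1) (α : V b Δ) (N : ℕ)
    (a : ℂ) (ha : ‖a‖ < 1) :
    dist (α.update N a ha) α = ‖a - α.1 N‖ * ((Δ * b) ^ N)⁻¹ := by
  -- `V.C` is a choice, so uniqueness is needed to see that changing one coefficient leaves it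
  -- alone; only the term `N` of the distance then survives.
  have hC : (α.update N a ha).C = α.C :=
    IsLeading.unique hb.1 hΔ (α.update N a ha).isLeading (α.isLeading.update N a)
  rw [V.dist_eq, vNorm, hC, sub_self, norm_zero, zero_add, tsum_eq_single N]
  · rw [remainder, zero_mul, sub_zero, Pi.sub_apply, V.update_val, Function.update_self, norm_mul,
      norm_mul, norm_inv, norm_inv, norm_pow, norm_pow, Complex.norm_real, Complex.norm_real,
      Real.norm_of_nonneg hb.1.le, Real.norm_of_nonneg hΔ.1.le, mul_pow, mul_inv, mul_assoc]
  · intro j hj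
    rw [remainder, zero_mul, sub_zero, Pi.sub_apply, V.update_val, Function.update_of_ne hj, sub_self]
    simp

/-! ### Openness and density -/

theorem szegoCont_zero (b : ℝ) (z : ℂ) (w : ℂ × ℂ) :
    szegoCont b 0 z w = (1 - b * z) * w.2 := by
  simp [szegoCont, szegoTerm]

/-- For the tail of a sequence, the contribution of the first component of the initial value
is eventually dominated by that of the second one, uniformly away from `b⁻¹`. -/
theorem Rates.eventually_tail_lt (h : Rates b t r) {α : ℕ → ℂ} (hα : α ∈ decaySet b t M)
    {Q : Set ℂ} (hQ : IsCompact Q) (hQr : ∀ z ∈ Q, ‖z‖ < r) (hQ0 : (0 : ℂ) ∉ Q)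
    (hQb : (b : ℂ)⁻¹ ∉ Q) :
    ∀ᶠ N : ℕ in atTop, ∀ z ∈ Q, ‖szegoCont b (fun k => α (N + k)) z (1, 0)‖
      < ‖z‖ * ‖szegoCont b (fun k => α (N + k)) z (0, 1)‖ := by
  have hM := nonneg_of_mem_decaySet hα
  have hb := h.b_pos
  have ht := h.t_nonneg
  have hzero : (0 : ℕ → ℂ) ∈ decaySet b t M := fun n => by
    simp only [Pi.zero_apply, norm_zero, mul_zero, sub_zero]
    exact ⟨by positivity, by positivity⟩
  let T := decaySet b t M
  have hcont : ∀ (w : ℂ × ℂ) (z : ℂ), ‖z‖ < r →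
      ContinuousAt (fun q : T × ℂ => szegoCont b q.1.1 q.2 w) (⟨0, hzero⟩, z) := by
    intro w z hz
    have hc : ContinuousOn (fun q : T × ℂ => szegoCont b q.1.1 q.2 w)
        (univ ×ˢ Metric.closedBall 0 r) :=
      (h.continuousOn_szegoCont M w).comp (f := fun q : T × ℂ => ((q.1 : ℕ → ℂ), q.2))
        (by fun_prop) fun q hq => ⟨q.1.2, hq.2⟩
    refine hc.continuousAt (prod_mem_nhds univ_mem ?_)
    exact mem_of_superset (Metric.isOpen_ball.mem_nhds (mem_ball_zero_iff.2 hz))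
      Metric.ball_subset_closedBall
  -- At the zero sequence the left side is `0` and the right side is `|z| |1 - b z| > 0` on `Q`. The
  -- strict inequality extends to nearby sequences by compactness, and the tails tend to zero inside
  -- the same `decaySet`.
  have hev : ∀ᶠ x : T in 𝓝 ⟨0, hzero⟩, ∀ z ∈ Q,
      ‖szegoCont b x.1 z (1, 0)‖ < ‖z‖ * ‖szegoCont b x.1 z (0, 1)‖ := by
    refine hQ.eventually_forall_of_forall_eventually fun z hz => ?_
    refine ContinuousAt.eventually_lt (hcont (1, 0) z (hQr z hz)).norm
      (continuousAt_snd.norm.mul (hcont (0, 1) z (hQr z hz)).norm) ?_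
    simp only [szegoCont_zero, mul_zero, norm_zero, mul_one]
    refine mul_pos (norm_pos_iff.2 fun h0 => hQ0 (h0 ▸ hz)) (norm_pos_iff.2 fun h0 => hQb ?_)
    rw [← (one_sub_mul_eq_zero_iff hb).1 h0]
    exact hz
  have htail : Tendsto (fun N : ℕ => (⟨fun k => α (N + k),
      shift_mem_decaySet hb h.b_lt_one ht h.t_lt_one hα N⟩ : T)) atTop (𝓝 ⟨0, hzero⟩) := by
    rw [tendsto_subtype_rng, tendsto_pi_nhds]
    intro k
    have h0 := (summable_norm_of_mem_decaySet hb h.b_lt_one hα).of_norm.tendsto_atTop_zero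
    exact (tendsto_add_atTop_iff_nat k).2 h0
  exact htail.eventually hev

/-- The dependence of `szegoCont` on a single coefficient is real-affine. -/
theorem Rates.szegoCont_update (h : Rates b t r) {M' : ℝ} {α : ℕ → ℂ} (hα : α ∈ decaySet b t M)
    {N : ℕ} {a : ℂ} (hβ : Function.update α N a ∈ decaySet b t M') {z : ℂ} (hz : ‖z‖ ≤ r) :
    szegoCont b (Function.update α N a) z (1, 1)
      = (z * (szegoSol α z (1, 1) N).1 - conj a * (szegoSol α z (1, 1) N).2)
          * szegoCont b (fun k => α (N + 1 + k)) z (1, 0)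
        + ((szegoSol α z (1, 1) N).2 - a * z * (szegoSol α z (1, 1) N).1)
          * szegoCont b (fun k => α (N + 1 + k)) z (0, 1) := by
  have htail : (fun k => Function.update α N a (N + 1 + k)) = fun k => α (N + 1 + k) := by
    ext k
    rw [Function.update_of_ne (by omega)]
  rw [h.szegoCont_shift hβ hz (1, 1) (N + 1), htail,
    h.szegoCont_linear (shift_mem_decaySet h.b_pos h.b_lt_one h.t_nonneg h.t_lt_one hα (N + 1)) hz,
    szegoSol_succ_fst, szegoSol_succ_snd, Function.update_self,
    szegoSol_congr (β := α) z (1, 1) N fun k hk => Function.update_of_ne hk.ne _ _]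

theorem contDiff_comp_circleMap {f : ℂ → ℂ} {R : ℝ} (hR0 : 0 ≤ R) (hR : R < r)
    (hf : DifferentiableOn ℂ f (Metric.ball 0 r)) :
    ContDiff ℝ 1 fun θ => f (circleMap 0 R θ) := by
  rw [contDiff_iff_contDiffAt]
  intro θ
  have hmem : circleMap 0 R θ ∈ Metric.ball (0 : ℂ) r := by
    rw [mem_ball_zero_iff, norm_circleMap_zero, abs_of_nonneg hR0]; exact hR
  have h1 : ContDiffAt ℂ 1 f (circleMap 0 R θ) :=
    (hf.contDiffOn Metric.isOpen_ball).contDiffAt (Metric.isOpen_ball.mem_nhds hmem)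
  exact (h1.restrict_scalars ℝ).comp θ (contDiff_circleMap 0 R).contDiffAt

/-- The values of a coefficient for which `szegoCont` has a zero on the circle `|z| = b⁻¹`,
at a point where `szegoCont` depends invertibly on this coefficient. -/
theorem Rates.dense_compl_update (h : Rates b t r) (hr : b⁻¹ < r) {α : ℕ → ℂ}
    (hα : α ∈ decaySet b t M) (h1 : ∀ j, ‖α j‖ < 1) (N : ℕ) :
    Dense {a : ℂ | ∃ z : ℂ, ‖z‖ = b⁻¹ ∧ (∃ M', Function.update α N a ∈ decaySet b t M') ∧
      ‖szegoCont b (fun k => α (N + 1 + k)) z (1, 0)‖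
        < ‖z‖ * ‖szegoCont b (fun k => α (N + 1 + k)) z (0, 1)‖ ∧
      szegoCont b (Function.update α N a) z (1, 1) = 0}ᶜ := by
  have hb0 : 0 ≤ b⁻¹ := (inv_pos.2 h.b_pos).le
  have hshift := shift_mem_decaySet h.b_pos h.b_lt_one h.t_nonneg h.t_lt_one hα (N + 1)
  have hA := contDiff_comp_circleMap hb0 hr (h.differentiableOn_szegoCont hshift (1, 0))
  have hB := contDiff_comp_circleMap hb0 hr (h.differentiableOn_szegoCont hshift (0, 1))
  have hu := contDiff_comp_circleMap hb0 hr
    (differentiable_szegoSol α (1, 1) N).1.differentiableOn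
  have hv := contDiff_comp_circleMap hb0 hr
    (differentiable_szegoSol α (1, 1) N).2.differentiableOn
  have hz := contDiff_comp_circleMap hb0 hr (f := fun z => z) differentiableOn_id
  -- With `A`, `B` the values of the tail at `(1, 0)`, `(0, 1)`, the equation reads `z u A + v B =
  -- conj a * (v A) + a * (z u B)`. The bounds `|v| ≤ |u|`, `u ≠ 0` and `|A| < |z| |B|` give `|v A|
  -- < |z u B|`.
  refine (dense_compl_solutions (((hz.mul hu).mul hA).add (hv.mul hB)) (hv.mul hA)
    ((hz.mul hu).mul hB)).mono (compl_subset_compl.2 ?_)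
  rintro a ⟨z, hzb, ⟨M', hβ⟩, hlt, h0⟩
  have hzr : ‖z‖ ≤ r := hzb.le.trans hr.le
  obtain ⟨θ, rfl⟩ : ∃ θ, circleMap 0 b⁻¹ θ = z := by
    have : z ∈ Metric.sphere (0 : ℂ) |b⁻¹| := by
      rw [mem_sphere_zero_iff_norm, hzb, abs_of_nonneg hb0]
    rwa [← range_circleMap] at this
  have h1b : 1 ≤ ‖circleMap 0 b⁻¹ θ‖ := by
    rw [hzb]; exact (one_le_inv₀ h.b_pos).2 h.b_lt_one.le
  obtain ⟨h2, h3⟩ := norm_snd_le_norm_fst_szegoSol h1 h1b N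
  refine ⟨θ, ?_, ?_⟩
  · rw [norm_mul, norm_mul, norm_mul]
    have h4 := mul_lt_mul_of_pos_left hlt (norm_pos_iff.2 h3)
    have h5 := mul_le_mul_of_nonneg_right h2
      (norm_nonneg (szegoCont b (fun k => α (N + 1 + k)) (circleMap 0 b⁻¹ θ) (1, 0)))
    linarith
  · rw [h.szegoCont_update hα hβ hzr] at h0
    linear_combination h0

theorem V.continuousAt_szegoCont (hb : b ∈ Ioo (0 : ℝ) 1) (hΔ : Δ ∈ Ioo (0 : ℝ) 1) {r : ℝ}
    (h : Rates b (Δ * b) r) (α : V b Δ) {z : ℂ} (hz : ‖z‖ < r) :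
    ContinuousAt (fun q : V b Δ × ℂ => szegoCont b q.1.1 q.2 (1, 1)) (α, z) := by
  have hval : Continuous fun q : V b Δ × ℂ => (q.1.1, q.2) :=
    ((V.continuous_val hb hΔ).comp continuous_fst).prodMk continuous_snd
  -- The unit ball around `α` lies in one `decaySet`, so a single majorant serves the whole
  -- neighbourhood.
  have hc : ContinuousOn (fun q : V b Δ × ℂ => szegoCont b q.1.1 q.2 (1, 1))
      (Metric.closedBall α 1 ×ˢ Metric.closedBall 0 r) :=
    (h.continuousOn_szegoCont (2 * (vNorm b Δ α.C α.1 + 1)) (1, 1)).comp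
      (f := fun q : V b Δ × ℂ => (q.1.1, q.2)) hval.continuousOn fun q hq =>
        ⟨V.mem_decaySet_of_dist_le hb hΔ α (β := q.1) hq.1, hq.2⟩
  refine hc.continuousAt (prod_mem_nhds (Metric.closedBall_mem_nhds α one_pos) ?_)
  exact mem_of_superset (Metric.isOpen_ball.mem_nhds (mem_ball_zero_iff.2 hz))
    Metric.ball_subset_closedBall

theorem V.szegoCont_inv_ne_zero (hb : b ∈ Ioo (0 : ℝ) 1) (hΔ : Δ ∈ Ioo (0 : ℝ) 1) {r : ℝ}
    (h : Rates b (Δ * b) r) (hr : b⁻¹ < r) (α : V b Δ) :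
    szegoCont b α.1 (b : ℂ)⁻¹ (1, 1) ≠ 0 :=
  h.szegoCont_inv_ne_zero (α.mem_decaySet hb hΔ) α.norm_lt_one hr.le
    (half_pos (norm_pos_iff.2 α.C_ne_zero))
    (eventually_le_norm_of_remainder_le hb hΔ α.C_ne_zero α.norm_remainder_le)

theorem isOpen_onlySingularPoint (hb : b ∈ Ioo (0 : ℝ) 1) (hΔ : Δ ∈ Ioo (0 : ℝ) 1) :
    IsOpen {α : V b Δ | OnlySingularPoint b α.1} := by
  obtain ⟨r, hr, h⟩ := exists_rates hb hΔ
  have hiff : ∀ α : V b Δ, OnlySingularPoint b α.1 ↔ _ := fun α =>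
    h.onlySingularPoint_iff (α.mem_decaySet hb hΔ) α.norm_lt_one hr
  rw [isOpen_iff_eventually]
  intro α hα
  -- Nonvanishing at `b⁻¹` too makes the set of points compact, so that the estimate is uniform.
  have hne : ∀ z ∈ Metric.sphere (0 : ℂ) b⁻¹, szegoCont b α.1 z (1, 1) ≠ 0 := by
    intro z hz
    rcases eq_or_ne z (b : ℂ)⁻¹ with rfl | hzb
    · exact α.szegoCont_inv_ne_zero hb hΔ h hr
    · exact (hiff α).1 hα z (mem_sphere_zero_iff_norm.1 hz) hzb
  have hev : ∀ᶠ β : V b Δ in 𝓝 α, ∀ z ∈ Metric.sphere (0 : ℂ) b⁻¹,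
      szegoCont b β.1 z (1, 1) ≠ 0 := by
    refine (isCompact_sphere (0 : ℂ) b⁻¹).eventually_forall_of_forall_eventually fun z hz => ?_
    exact (α.continuousAt_szegoCont hb hΔ h
      ((mem_sphere_zero_iff_norm.1 hz).trans_lt hr)).eventually_ne (hne z hz)
  filter_upwards [hev] with β hβ
  exact (hiff β).2 fun z hz _ => hβ z (mem_sphere_zero_iff_norm.2 hz)

theorem dense_onlySingularPoint (hb : b ∈ Ioo (0 : ℝ) 1) (hΔ : Δ ∈ Ioo (0 : ℝ) 1) :
    Dense {α : V b Δ | OnlySingularPoint b α.1} := by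
  obtain ⟨r, hr, h⟩ := exists_rates hb hΔ
  have hb0 := hb.1
  have hbi : 0 < b⁻¹ := inv_pos.2 hb0
  have hΔb : 0 < Δ * b := mul_pos hΔ.1 hb0
  refine Metric.dense_iff.2 fun α ε hε => ?_
  obtain ⟨δ, hδ, hnear⟩ : ∃ δ > 0, ∀ β : V b Δ, dist β α < δ → ∀ z : ℂ,
      dist z (b : ℂ)⁻¹ < δ → szegoCont b β.1 z (1, 1) ≠ 0 := by
    have hev := (α.continuousAt_szegoCont hb hΔ h
      ((norm_ofReal_inv hb0).trans_lt hr)).eventually_ne (α.szegoCont_inv_ne_zero hb hΔ h hr)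
    obtain ⟨δ, hδ, hsub⟩ := Metric.eventually_nhds_iff.1 hev
    exact ⟨δ, hδ, fun β hβ z hz => hsub (y := (β, z)) (max_lt hβ hz)⟩
  set Q : Set ℂ := Metric.sphere 0 b⁻¹ \ Metric.ball (b : ℂ)⁻¹ δ with hQ
  have hQc : IsCompact Q := (isCompact_sphere _ _).diff Metric.isOpen_ball
  have hαd := α.mem_decaySet hb hΔ
  -- The coefficient changed has index `N`, so the tail to control starts at `N + 1`.
  obtain ⟨N, hN⟩ := ((tendsto_add_atTop_nat 1).eventually (h.eventually_tail_lt hαd hQc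
    (fun z hz => (mem_sphere_zero_iff_norm.1 hz.1).trans_lt hr)
    (fun h0 => hbi.ne (by simpa using mem_sphere_zero_iff_norm.1 h0.1))
    (fun h0 => h0.2 (Metric.mem_ball_self hδ)))).exists
  obtain ⟨a, ha, hball⟩ := (h.dense_compl_update hr hαd α.norm_lt_one N).exists_dist_lt (α.1 N)
    -- The first bound keeps `|a| < 1`; the second compensates the weight `(Δ b)⁻ᴺ` in the distance,
    -- which must be below both `δ` and `ε`.
    (ε := min (1 - ‖α.1 N‖) (min δ ε * (Δ * b) ^ N))
    (lt_min (sub_pos.2 (α.norm_lt_one N)) (by positivity))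
  rw [dist_comm, dist_eq_norm, lt_min_iff] at hball
  have ha1 : ‖a‖ < 1 := by
    have := norm_add_le (α.1 N) (a - α.1 N)
    rw [add_sub_cancel] at this
    linarith [hball.1]
  set β := α.update N a ha1 with hβ
  have hdist : dist β α < min δ ε := by
    rw [hβ, V.dist_update hb hΔ, ← div_eq_mul_inv, div_lt_iff₀ (by positivity)]
    exact hball.2
  refine ⟨β, hdist.trans_le (min_le_right _ _), ?_⟩
  refine (h.onlySingularPoint_iff (β.mem_decaySet hb hΔ) β.norm_lt_one hr).2 fun z hz hzb h0 => ?_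
  by_cases hzδ : dist z (b : ℂ)⁻¹ < δ
  · exact hnear β (hdist.trans_le (min_le_left _ _)) z hzδ h0
  · exact ha ⟨z, hz, ⟨_, β.mem_decaySet hb hΔ⟩,
      hN z ⟨mem_sphere_zero_iff_norm.2 hz, hzδ⟩, h0⟩

end

end OPUC

theorem theorem13p3 (b Δ : ℝ) (hb : b ∈ Set.Ioo (0 : ℝ) 1) (hΔ : Δ ∈ Set.Ioo (0 : ℝ) 1) :
    IsOpen {α : OPUC.V b Δ | OPUC.OnlySingularPoint b α.1} ∧
      Dense {α : OPUC.V b Δ | OPUC.OnlySingularPoint b α.1} :=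
  ⟨OPUC.isOpen_onlySingularPoint hb hΔ, OPUC.dense_onlySingularPoint hb hΔ⟩
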